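/- Fix integers $K, M\ge 1$ (number of frames, number of slots per frame), real rates $R_s$ and $R_{{\rm d},1},\dots,R_{{\rm d},K}$, probability laws $p_{X_1},\dots,p_{X_K}$ on an input alphabet $\mathcal X$, and, for every frame $k$ and slot $m$, a memoryless channel $p(Z_{k,m}\mid X_{k,m})$ from $\mathcal X$ to Eve's output alphabet $\mathcal Z$ (a Markov kernel; the alphabets are standard Borel spaces). The family $\boldsymbol p$ of these channels is the channel realization. Logarithms are to base 2. For $n\ge 1$ let $C_n=(C_{n,1},\dots,C_{n,K})$ be the random HARQ code: for each frame $k$ and each pair $(a,b)$ with $1\le a\le \lceil 2^{nR_s}\rceil$, $1\le b\le\lceil 2^{nR_{{\rm d},k}}\rceil$, the word $X_k^{nM}(a,b)=[X_{k,1}^n(a,b),\dots,X_{k,M}^n(a,b)]$ consists of $M$ blocks of $n$ symbols, where all symbols of all words of all frames are independent and those of frame $k$ have law $p_{X_k}$. The secret message $\mathcal M$ is uniform on $\{1,\dots,\lceil 2^{nR_s}\rceil\}$; independently of it and of each other, the random messages $j_k$ are uniform on $\{1,\dots,\lceil 2^{nR_{{\rm d},k}}\rceil\}$. In slot $m$ of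 frame $k$ Alice transmits $X^n_{k,m}(\mathcal M,j_k)$ and Eve receives $Z^n_{k,m}$, the output of $n$ independent uses of the channel $p(Z_{k,m}\mid X_{k,m})$. The leakage of a code $C_n$ up to slot $M'$ of frame $K'$ is the mutual information $$ {\rm L}(C_n|\boldsymbol p,M',K')={\rm I}\bigl(\mathcal M;\,Z^{n}_{k,m}\ (k<K',\,1\le m\le M),\ Z^n_{K',1},\dots,Z^n_{K',M'}\,\bigm|\,C_n,\boldsymbol p\bigr)$$ for that fixed code, and $I^{\rm E}_{k,m}=\lim_{n\to\infty}\frac1n {\rm I}(X^n;Z^n)$, where $X^n$ consists of $n$ independent symbols of law $p_{X_k}$ and $Z^n$ is the output of $n$ uses of $p(Z_{k,m}\mid X_{k,m})$ with input $X^n$. Let $1\le K'\le K$ and $1\le M'\le M$ be such that $$\sum_{m=1}^{M} I^{\rm E}_{k,m}<R_{{\rm d},k}\quad (k=1,\dots,K'-1),\qquad \sum_{m=1}^{M'} I^{\rm E}_{K',m}<R_{{\rm d},K'} .$$ Then there are a nonnegative function $\delta(\epsilon)$ with $\delta(\epsilon)\to 0$ as $\epsilon\to 0^+$ and, for each $\epsilon>0$,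 a nonnegative sequence $\delta_\epsilon(n)$ with $\delta_\epsilon(n)\to 0$ as $n\to\infty$, such that for all $\epsilon>0$ and all $n\ge 1$ the leakage is a measurable function of the code and $${\rm E}_{C_n}\Bigl[\tfrac1n\,{\rm L}(C_n|\boldsymbol p,M',K')\Bigr]\le K'\,\delta(\epsilon)+K'\,\delta_\epsilon(n).$$ -/

import Mathlib

open MeasureTheory ProbabilityTheory InformationTheory Filter Topology
open scoped ENNReal NNReal

namespace SHARQ

noncomputable section

/-- Mutual information, in bits, of the two components of a random pair with law `ρ`: the
Kullback-Leibler divergence of the joint law from the product of its marginals. -/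
def mutualInfo {α β : Type*} [MeasurableSpace α] [MeasurableSpace β]
    (ρ : Measure (α × β)) : ℝ≥0∞ :=
  klDiv ρ (ρ.fst.prod ρ.snd) / ENNReal.ofReal (Real.log 2)

/-- The law of `(X^n, Z^n)`, where `X^n` has `n` independent symbols of law `p` and `Z^n` is the
output of `n` uses of the memoryless channel `W` with input `X^n`: the `n` symbol pairs
`(X_t, Z_t)` are independent with law `p ⊗ₘ W`. -/
def blockLaw {𝓧 𝓩 : Type*} [MeasurableSpace 𝓧] [MeasurableSpace 𝓩]
    (p : Measure 𝓧) (W : Kernel 𝓧 𝓩) (n : ℕ) : Measure ((Fin n → 𝓧) × (Fin n → 𝓩)) :=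
  (Measure.pi fun _ : Fin n => p ⊗ₘ W).map fun ω => (fun t => (ω t).1, fun t => (ω t).2)

/-- The mutual information of a slot, `lim_{n → ∞} (1/n) I(X^n; Z^n)`, in bits per symbol. The
limit exists, see `tendsto_mutualInfo_blockLaw`. -/
def slotInfo {𝓧 𝓩 : Type*} [MeasurableSpace 𝓧] [MeasurableSpace 𝓩]
    (p : Measure 𝓧) (W : Kernel 𝓧 𝓩) : ℝ≥0∞ :=
  limUnder atTop fun n : ℕ => mutualInfo (blockLaw p W n) / (n : ℝ≥0∞)

/-- The number of messages that bear `n R` bits: `2^{nR}`, rounded up to an integer. -/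
def numMessages (n : ℕ) (R : ℝ) : ℕ := ⌈(2 : ℝ) ^ ((n : ℝ) * R)⌉₊

/-- A frame code: a word of `M` slots of `n` symbols for each pair (secret message,
random message). -/
abbrev FrameCode (𝓧 : Type*) (M n A B : ℕ) : Type _ :=
  Fin A × Fin B → Fin M → Fin n → 𝓧

/-- A HARQ code: one frame code for each of the `K` frames, all of them for the same set of `A`
secret messages, frame `k` having `B k` random messages. -/
abbrev HarqCode (𝓧 : Type*) {K : ℕ} (M n A : ℕ) (B : Fin K → ℕ) : Type _ :=
  (k : Fin K) → FrameCode 𝓧 M n A (B k)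

/-- The law of the random HARQ code: all symbols of all words are independent, those of frame `k`
having law `pX k`. -/
def codeLaw {𝓧 : Type*} [MeasurableSpace 𝓧] {K : ℕ} (M n A : ℕ) (B : Fin K → ℕ)
    (pX : Fin K → Measure 𝓧) : Measure (HarqCode 𝓧 M n A B) :=
  Measure.pi fun k => Measure.pi fun _ : Fin A × Fin (B k) =>
    Measure.pi fun _ : Fin M => Measure.pi fun _ : Fin n => pX k

/-- The pairs (frame, slot) that are transmitted up to and including slot `m'` of frame `k'`. -/
abbrev SlotsUpTo {K M : ℕ} (k' : Fin K) (m' : Fin M) : Type :=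
  {q : Fin K × Fin M // q.1 < k' ∨ q.1 = k' ∧ q.2 ≤ m'}

/-- The law of the indices `(i, (j_k)_k)`: the secret message and the random messages of all the
frames are independent and uniform. -/
def indexLaw {K : ℕ} (A : ℕ) (B : Fin K → ℕ) : Measure (Fin A × ((k : Fin K) → Fin (B k))) :=
  (uniformOn Set.univ).prod (Measure.pi fun _ => uniformOn Set.univ)

/-- The conditional law, given the indices `(i, (j_k)_k)`, of what Eve receives up to slot `m'` of
frame `k'` when Alice uses the code `c`: the symbol `t` of slot `m` of frame `k` is the output
of the channel `W k m` for the input symbol `t` of slot `m` of the word `X_k(i, j_k)`. -/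
def eveKernel {𝓧 𝓩 : Type*} [MeasurableSpace 𝓧] [MeasurableSpace 𝓩] {K M n A : ℕ}
    {B : Fin K → ℕ} (W : Fin K → Fin M → Kernel 𝓧 𝓩) (k' : Fin K) (m' : Fin M)
    (c : HarqCode 𝓧 M n A B) :
    Kernel (Fin A × ((k : Fin K) → Fin (B k))) (SlotsUpTo k' m' → Fin n → 𝓩) :=
  Kernel.ofFunOfCountable fun ij => Measure.pi fun q => Measure.pi fun t =>
    W q.1.1 q.1.2 (c q.1.1 (ij.1, ij.2 q.1.1) q.1.2 t)

/-- The information leakage (in bits) of the code `c` up to slot `m'` of frame `k'`: the mutual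
information of the secret message and of what Eve has received. -/
def leakage {𝓧 𝓩 : Type*} [MeasurableSpace 𝓧] [MeasurableSpace 𝓩] {K M n A : ℕ}
    {B : Fin K → ℕ} (W : Fin K → Fin M → Kernel 𝓧 𝓩) (k' : Fin K) (m' : Fin M)
    (c : HarqCode 𝓧 M n A B) : ℝ≥0∞ :=
  mutualInfo ((indexLaw A B ⊗ₘ eveKernel W k' m' c).map fun ω => (ω.1.1, ω.2))

/-! The limit that defines `slotInfo` exists. -/

theorem klDiv_map_measurableEquiv {α β : Type*} [MeasurableSpace α] [MeasurableSpace β]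
    (μ ν : Measure α) [IsFiniteMeasure μ] [IsFiniteMeasure ν] (e : α ≃ᵐ β) :
    klDiv (μ.map e) (ν.map e) = klDiv μ ν := by
  have : IsFiniteMeasure (μ.map e) := Measure.isFiniteMeasure_map μ e
  have : IsFiniteMeasure (ν.map e) := Measure.isFiniteMeasure_map ν e
  refine le_antisymm (klDiv_map_le μ ν e.measurable) ?_
  have h := klDiv_map_le (μ.map e) (ν.map e) e.symm.measurable
  simpa [Measure.map_map e.symm.measurable e.measurable] using h

theorem klDiv_prod {α β : Type*} [MeasurableSpace α] [MeasurableSpace β]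
    (μ ν : Measure α) (μ' ν' : Measure β) [IsProbabilityMeasure μ] [IsProbabilityMeasure ν]
    [IsProbabilityMeasure μ'] [IsProbabilityMeasure ν'] :
    klDiv (μ.prod μ') (ν.prod ν') = klDiv μ ν + klDiv μ' ν' := by
  have h1 := klDiv_compProd_eq_add (μ := μ) (ν := ν) (κ := Kernel.const α μ')
    (η := Kernel.const α ν')
  have h2 := klDiv_compProd_left (μ := μ') (ν := ν') (κ := Kernel.const β μ)
  have h3 := klDiv_map_measurableEquiv (μ'.prod μ) (ν'.prod μ) MeasurableEquiv.prodComm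
  simp only [Measure.compProd_const] at h1 h2
  have h4 : ∀ ρ : Measure β, IsProbabilityMeasure ρ →
      (ρ.prod μ).map (MeasurableEquiv.prodComm : β × α ≃ᵐ α × β) = μ.prod ρ :=
    fun ρ _ => Measure.prod_swap
  rw [h4 μ' inferInstance, h4 ν' inferInstance] at h3
  rw [h1, h3, h2]

theorem klDiv_pi {α : Type*} [MeasurableSpace α] (μ ν : Measure α) [IsProbabilityMeasure μ]
    [IsProbabilityMeasure ν] (n : ℕ) :
    klDiv (Measure.pi fun _ : Fin n => μ) (Measure.pi fun _ : Fin n => ν) = n * klDiv μ ν := by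
  induction n with
  | zero =>
    rw [Measure.pi_of_empty (fun _ : Fin 0 => μ), Measure.pi_of_empty (fun _ : Fin 0 => ν)]
    simp
  | succ n ih =>
    have h := klDiv_map_measurableEquiv (Measure.pi fun _ : Fin (n + 1) => μ)
      (Measure.pi fun _ : Fin (n + 1) => ν) (MeasurableEquiv.piFinSuccAbove (fun _ => α) 0)
    rw [(measurePreserving_piFinSuccAbove (fun _ : Fin (n + 1) => μ) 0).map_eq,
      (measurePreserving_piFinSuccAbove (fun _ : Fin (n + 1) => ν) 0).map_eq, klDiv_prod, ih] at h
    rw [← h]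
    push_cast
    ring

theorem mutualInfo_blockLaw {𝓧 𝓩 : Type*} [MeasurableSpace 𝓧] [MeasurableSpace 𝓩]
    (p : Measure 𝓧) [IsProbabilityMeasure p] (W : Kernel 𝓧 𝓩) [IsMarkovKernel W] (n : ℕ) :
    mutualInfo (blockLaw p W n) = n * mutualInfo (p ⊗ₘ W) := by
  set ρ := p ⊗ₘ W with hρ
  let e := MeasurableEquiv.arrowProdEquivProdArrow 𝓧 𝓩 (Fin n)
  have hb : blockLaw p W n = (Measure.pi fun _ : Fin n => ρ).map e := rfl
  have hf : (blockLaw p W n).fst = Measure.pi fun _ : Fin n => ρ.fst := by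
    rw [hb, Measure.fst, Measure.map_map measurable_fst e.measurable]
    exact Measure.pi_map_pi (μ := fun _ : Fin n => ρ) fun _ => measurable_fst.aemeasurable
  have hs : (blockLaw p W n).snd = Measure.pi fun _ : Fin n => ρ.snd := by
    rw [hb, Measure.snd, Measure.map_map measurable_snd e.measurable]
    exact Measure.pi_map_pi (μ := fun _ : Fin n => ρ) fun _ => measurable_snd.aemeasurable
  have hp : (blockLaw p W n).fst.prod (blockLaw p W n).snd =
      (Measure.pi fun _ : Fin n => ρ.fst.prod ρ.snd).map e := by
    rw [hf, hs]
    exact (measurePreserving_arrowProdEquivProdArrow 𝓧 𝓩 (Fin n)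
      (fun _ => ρ.fst) (fun _ => ρ.snd)).map_eq.symm
  rw [mutualInfo, hp, hb, klDiv_map_measurableEquiv, klDiv_pi, mutualInfo, mul_div_assoc]

theorem tendsto_mutualInfo_blockLaw {𝓧 𝓩 : Type*} [MeasurableSpace 𝓧] [MeasurableSpace 𝓩]
    (p : Measure 𝓧) [IsProbabilityMeasure p] (W : Kernel 𝓧 𝓩) [IsMarkovKernel W] :
    Tendsto (fun n : ℕ => mutualInfo (blockLaw p W n) / (n : ℝ≥0∞)) atTop
      (𝓝 (mutualInfo (p ⊗ₘ W))) := by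
  refine tendsto_const_nhds.congr' ?_
  filter_upwards [eventually_ge_atTop 1] with n hn
  rw [mutualInfo_blockLaw, mul_comm]
  exact (ENNReal.mul_div_cancel_right (by simpa using Nat.one_le_iff_ne_zero.mp hn)
    (ENNReal.natCast_ne_top n)).symm

/-- The limit is the single-letter mutual information. -/
theorem slotInfo_eq {𝓧 𝓩 : Type*} [MeasurableSpace 𝓧] [MeasurableSpace 𝓩]
    (p : Measure 𝓧) [IsProbabilityMeasure p] (W : Kernel 𝓧 𝓩) [IsMarkovKernel W] :
    slotInfo p W = mutualInfo (p ⊗ₘ W) :=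
  (tendsto_mutualInfo_blockLaw p W).limUnder_eq

end

end SHARQ

/-!
The estimate is a soft-covering (channel resolvability) argument, carried out for the
Kullback-Leibler divergence under the sole assumption that the mutual informations are finite.

*Comparison with a product law.* The mutual information of the secret message and of Eve's
observation is at most the divergence of their joint law from `uniform × Q`, for any law `Q` of the
observation (`klDiv_fst_prod_snd_le`). Take for `Q` the law `outputLaw`, under which all the
received symbols are independent, each with the output law of its channel. Because the mutual
informations are finite, almost every code gives the joint law a density with respect to
`uniform × Q`. It is a product over the frames, and its factor for frame `k` is the average over
the `B k` random messages of the density `w` of a single word (`receivedLaw_eq_withDensity`).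

*Averaging over the codes.* The divergence of a law with density `g` is at most the integral of
`g log (1 + g)` (`klDiv_withDensity_le`), and `log (1 + ∏ g_k) ≤ ∑ log (1 + g_k)` separates the
frames. Fix an observation `z`. For `Q`-almost every `z`, the density `w(X, z)` of a random word has
mean one, so that the frames `l ≠ k` integrate out of the term `log (1 + g_k)`. In that frame, the
inequality `log (1 + x + y) ≤ log (1 + x) + y` separates the word that was sent from the others, and
the independence of the words gives
`E [g_k log (1 + g_k)] ≤ E [w log (1 + w / B k)] + 1` (`lintegral_average_mul_log1p_le`).

*Law of large numbers.* The logarithm of `w` is a sum of independent information densities, with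
mean `n` times the sum of the mutual informations of the slots of the frame, which is at most
`log (B k)` by hypothesis. Hence `log (1 + w / B k)` is at most `log 2` plus the sum over the slots
of the deviations of these sums from their means (`log1p_prod_div_le`). The law of `(X, Z)` with
density `w` is that of independent pairs of inputs and outputs, and the expected deviations are
`o(n)` by the law of large numbers in `L¹` (`tendsto_lintegral_sum_sub_integral`). Division by `n`
leaves a quantity that tends to `0` (`tendsto_leakageRateBound`). It involves no `ε`, and therefore
the theorem holds with `δ = 0`.

The measurability of the leakage in the code comes from the joint measurability of Radon-Nikodym
derivatives of kernels (`measurable_klDiv_kernel`).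
-/

namespace SHARQ

noncomputable section

/-! ### Integrals over product measures, and measurability -/

/-- Coordinates with distinct indices are independent: the integral of a product of functions of
such coordinates factorizes. -/
theorem lintegral_pi_prod_comp {ι κ : Type*} [Fintype ι] {α : ι → Type*}
    [∀ i, MeasurableSpace (α i)] (μ : ∀ i, Measure (α i)) [∀ i, IsProbabilityMeasure (μ i)]
    (s : Finset κ) (e : κ → ι) (he : Set.InjOn e s) (f : ∀ k, α (e k) → ℝ≥0∞)
    (hf : ∀ k, Measurable (f k)) :
    ∫⁻ x, ∏ k ∈ s, f k (x (e k)) ∂Measure.pi μ = ∏ k ∈ s, ∫⁻ y, f k y ∂μ (e k) := by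
  have h1 : iIndepFun (fun (i : ι) (x : ∀ i, α i) => x i) (Measure.pi μ) :=
    iIndepFun_pi (X := fun _ y => y) fun _ => measurable_id.aemeasurable
  have hinj : Function.Injective fun k : s => e k.1 := fun a b hab =>
    Subtype.ext (he a.2 b.2 hab)
  have h2 := (h1.precomp hinj).comp (fun k : s => f k.1) fun k => hf k.1
  have h3 := lintegral_prod_eq_prod_lintegral_of_indepFun Finset.univ
    (fun (k : s) (x : ∀ i, α i) => f k.1 (x (e k.1))) h2
    (fun k => (hf k.1).comp (measurable_pi_apply _))
  have h4 : ∀ k : κ, ∫⁻ x, f k (x (e k)) ∂Measure.pi μ = ∫⁻ y, f k y ∂μ (e k) := fun k =>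
    (measurePreserving_eval μ (e k)).lintegral_comp (hf k)
  simp only [h4] at h3
  rw [← Finset.prod_coe_sort, ← h3]
  refine lintegral_congr fun x => ?_
  rw [← Finset.prod_coe_sort]

theorem pi_withDensity {ι : Type*} [Fintype ι] {α : ι → Type*}
    [∀ i, MeasurableSpace (α i)] (μ : ∀ i, Measure (α i)) [∀ i, IsProbabilityMeasure (μ i)]
    (f : ∀ i, α i → ℝ≥0∞) (hf : ∀ i, Measurable (f i))
    [∀ i, SigmaFinite ((μ i).withDensity (f i))] :
    Measure.pi (fun i => (μ i).withDensity (f i)) =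
      (Measure.pi μ).withDensity fun x => ∏ i, f i (x i) := by
  refine (Measure.pi_eq fun s hs => ?_)
  rw [withDensity_apply _ (MeasurableSet.univ_pi hs),
    ← lintegral_indicator (MeasurableSet.univ_pi hs)]
  have h := lintegral_pi_prod_comp μ Finset.univ id (Set.injOn_id _)
    (fun i => (s i).indicator (f i)) fun i => (hf i).indicator (hs i)
  simp only [id, lintegral_indicator (hs _)] at h
  simp only [withDensity_apply _ (hs _), ← h]
  refine lintegral_congr fun x => ?_
  by_cases hx : ∀ i, x i ∈ s i
  · rw [Set.indicator_of_mem (by simpa using hx)]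
    exact Finset.prod_congr rfl fun i _ => (Set.indicator_of_mem (hx i) _).symm
  · rw [Set.indicator_of_notMem (by simpa using hx)]
    push Not at hx
    obtain ⟨i, hi⟩ := hx
    exact (Finset.prod_eq_zero (Finset.mem_univ i) (Set.indicator_of_notMem hi _)).symm

theorem measurable_measure_pi {β ι : Type*} [MeasurableSpace β] [Fintype ι] {α : ι → Type*}
    [∀ i, MeasurableSpace (α i)] (μ : β → ∀ i, Measure (α i))
    [∀ b i, IsProbabilityMeasure (μ b i)] (hμ : ∀ i, Measurable fun b => μ b i) :
    Measurable fun b => Measure.pi (μ b) := by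
  refine Measurable.measure_of_isPiSystem_of_isProbabilityMeasure generateFrom_pi.symm
    isPiSystem_pi ?_
  rintro _ ⟨s, hs, rfl⟩
  simp only [Measure.pi_pi]
  exact Finset.measurable_prod _ fun i _ =>
    (Measure.measurable_coe (hs i (Set.mem_univ i))).comp (hμ i)

theorem measurable_klDiv_kernel {α β : Type*} [MeasurableSpace α] [MeasurableSpace β]
    [MeasurableSpace.CountableOrCountablyGenerated α β]
    (κ η : Kernel α β) [IsFiniteKernel κ] [IsFiniteKernel η] :
    Measurable fun a => klDiv (κ a) (η a) := by
  classical
  have h : (fun a => klDiv (κ a) (η a)) = fun a => if κ a ≪ η a then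
      ∫⁻ x, ENNReal.ofReal (klFun (κ.rnDeriv η a x).toReal) ∂η a else ∞ := by
    ext a
    rw [klDiv_eq_lintegral_klFun]
    congr 1
    refine lintegral_congr_ae ?_
    filter_upwards [Kernel.rnDeriv_eq_rnDeriv_measure (κ := κ) (η := η) (a := a)] with x hx
    rw [hx]
  rw [h]
  refine Measurable.ite (Kernel.measurableSet_absolutelyContinuous κ η) ?_ measurable_const
  exact Measurable.lintegral_kernel_prod_right (f := fun a x =>
    ENNReal.ofReal (klFun (κ.rnDeriv η a x).toReal))
    (measurable_klFun.comp (Kernel.measurable_rnDeriv κ η).ennreal_toReal).ennreal_ofReal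

/-! ### Bounds on the Kullback-Leibler divergence -/

/-- The golden formula, as an inequality: among the product measures with first factor `ρ.fst`,
the divergence from `ρ` is smallest for the product of the marginals. Disintegration of `ρ` over
its second component turns this into the chain rule. -/
theorem klDiv_fst_prod_snd_le {α β : Type*} [MeasurableSpace α] [StandardBorelSpace α]
    [Nonempty α] [MeasurableSpace β] (ρ : Measure (α × β)) [IsProbabilityMeasure ρ]
    (Q : Measure β) [IsProbabilityMeasure Q] :
    klDiv ρ (ρ.fst.prod ρ.snd) ≤ klDiv ρ (ρ.fst.prod Q) := by
  let e : α × β ≃ᵐ β × α := MeasurableEquiv.prodComm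
  have hs : ∀ τ : Measure β, IsProbabilityMeasure τ →
      (ρ.fst.prod τ).map e = τ ⊗ₘ Kernel.const β ρ.fst := fun τ _ => by
    rw [Measure.compProd_const]
    exact Measure.prod_swap
  have hr : ρ.map e = ρ.snd ⊗ₘ (ρ.map e).condKernel := by
    have h := (ρ.map e).disintegrate (ρ.map e).condKernel
    have hf : (ρ.map e).fst = ρ.snd := Measure.fst_map_swap
    rw [hf] at h
    exact h.symm
  rw [← klDiv_map_measurableEquiv ρ (ρ.fst.prod ρ.snd) e,
    ← klDiv_map_measurableEquiv ρ (ρ.fst.prod Q) e, hs _ inferInstance, hs _ inferInstance, hr,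
    klDiv_compProd_eq_add (ν := Q)]
  exact le_add_self

/-- The natural logarithm `log (1 + x)` of a nonnegative number, as a nonnegative number. -/
def log1p (x : ℝ≥0) : ℝ≥0 := (Real.log (1 + x)).toNNReal

@[fun_prop]
theorem measurable_log1p : Measurable log1p := by
  unfold log1p
  fun_prop

theorem coe_log1p (x : ℝ≥0) : (log1p x : ℝ) = Real.log (1 + x) :=
  Real.coe_toNNReal _ (Real.log_nonneg (by simp))

/-- This inequality makes Jensen's inequality unnecessary in the soft-covering argument: the
summand `y` will have mean at most one, and an additive constant disappears after normalization. -/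
theorem log1p_add_le (x y : ℝ≥0) : log1p (x + y) ≤ log1p x + y := by
  rw [← NNReal.coe_le_coe]
  push_cast
  rw [coe_log1p, coe_log1p]
  have hx : (0 : ℝ) < 1 + x := by positivity
  have hy : (0 : ℝ) ≤ y := y.2
  have h : (1 : ℝ) + ((x + y : ℝ≥0) : ℝ) ≤ (1 + x) * (1 + y) := by
    push_cast
    nlinarith [mul_nonneg x.2 y.2, x.2]
  calc Real.log (1 + ((x + y : ℝ≥0) : ℝ)) ≤ Real.log ((1 + x) * (1 + y)) :=
        Real.log_le_log (by positivity) h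
    _ = Real.log (1 + x) + Real.log (1 + y) := Real.log_mul hx.ne' (by positivity)
    _ ≤ Real.log (1 + x) + y := by
        have := Real.log_le_sub_one_of_pos (show (0 : ℝ) < 1 + y by positivity)
        linarith

theorem log1p_mul_le (x y : ℝ≥0) : log1p (x * y) ≤ log1p x + log1p y := by
  rw [← NNReal.coe_le_coe]
  push_cast
  rw [coe_log1p, coe_log1p, coe_log1p, ← Real.log_mul (by positivity) (by positivity)]
  refine Real.log_le_log (by positivity) ?_
  push_cast
  nlinarith [x.2, y.2]

theorem log1p_prod_le {ι : Type*} (s : Finset ι) (hs : s.Nonempty) (f : ι → ℝ≥0) :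
    log1p (∏ i ∈ s, f i) ≤ ∑ i ∈ s, log1p (f i) := by
  induction hs using Finset.Nonempty.cons_induction with
  | singleton a => simp
  | cons a s ha _ ih =>
    rw [Finset.prod_cons, Finset.sum_cons]
    exact (log1p_mul_le _ _).trans (by gcongr)

/-- A bound on the divergence with a nonnegative integrand, so that Tonelli's theorem applies to
it without integrability hypotheses. -/
theorem klDiv_withDensity_le {α : Type*} [MeasurableSpace α] (μ ν : Measure α)
    [IsProbabilityMeasure μ] [IsProbabilityMeasure ν] (g : α → ℝ≥0) (hg : Measurable g)
    (h : μ = ν.withDensity fun x => (g x : ℝ≥0∞)) :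
    klDiv μ ν ≤ ∫⁻ x, (g x * log1p (g x) : ℝ≥0) ∂ν := by
  have hac : μ ≪ ν := h ▸ withDensity_absolutelyContinuous _ _
  have hrn : μ.rnDeriv ν =ᵐ[ν] fun x => (g x : ℝ≥0∞) := by
    rw [h]
    exact Measure.rnDeriv_withDensity ν hg.coe_nnreal_ennreal
  have h1 : ∫⁻ x, (g x : ℝ≥0∞) ∂ν = 1 := by
    have := measure_univ (μ := μ)
    rwa [h, withDensity_apply _ MeasurableSet.univ, Measure.restrict_univ] at this
  rw [klDiv_eq_lintegral_klFun_of_ac hac]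
  have h2 : ∫⁻ x, ENNReal.ofReal (klFun (μ.rnDeriv ν x).toReal) ∂ν =
      ∫⁻ x, ENNReal.ofReal (klFun (g x)) ∂ν := by
    refine lintegral_congr_ae ?_
    filter_upwards [hrn] with x hx
    rw [hx, ENNReal.coe_toReal]
  rw [h2]
  -- Both sides increased by `1 = ∫ g` compare pointwise, since `klFun g + g = g log g + 1`.
  refine (ENNReal.add_le_add_iff_right ENNReal.one_ne_top).1 ?_
  calc ∫⁻ x, ENNReal.ofReal (klFun (g x)) ∂ν + 1
      = ∫⁻ x, (ENNReal.ofReal (klFun (g x)) + g x) ∂ν := by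
        rw [lintegral_add_right _ hg.coe_nnreal_ennreal, h1]
    _ ≤ ∫⁻ x, ((g x * log1p (g x) : ℝ≥0) + 1 : ℝ≥0∞) ∂ν := by
        refine lintegral_mono fun x => ?_
        rw [← ENNReal.ofReal_coe_nnreal (p := g x),
          ← ENNReal.ofReal_coe_nnreal (p := g x * log1p (g x)), ← ENNReal.ofReal_one,
          ← ENNReal.ofReal_add (klFun_nonneg (g x).coe_nonneg) (g x).coe_nonneg,
          ← ENNReal.ofReal_add (by positivity) zero_le_one]
        refine ENNReal.ofReal_le_ofReal ?_
        rw [klFun_apply]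
        push_cast
        rw [coe_log1p]
        rcases eq_or_lt_of_le (g x).coe_nonneg with h0 | h0
        · have h0' : (g x : ℝ) = 0 := h0.symm
          simp [h0']
        · have := Real.log_le_log h0 (show ((g x : ℝ)) ≤ 1 + g x by simp)
          have h5 := mul_le_mul_of_nonneg_left this h0.le
          linarith
    _ = ∫⁻ x, (g x * log1p (g x) : ℝ≥0) ∂ν + 1 := by
        rw [lintegral_add_right _ measurable_const]
        simp

/-! ### The law of large numbers and the information density -/

/-- The law of large numbers in `L¹`, for the finite product measures: the expected deviation of
a sum of `n` independent copies of `f` from its mean is `o(n)`. -/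
theorem tendsto_lintegral_sum_sub_integral {Ω : Type*} [MeasurableSpace Ω] (ρ : Measure Ω)
    [IsProbabilityMeasure ρ] (f : Ω → ℝ) (hf : Measurable f) (hi : Integrable f ρ) :
    Tendsto (fun n : ℕ => (∫⁻ ω, ‖∑ t, f (ω t) - n * ∫ x, f x ∂ρ‖ₑ
      ∂Measure.pi fun _ : Fin n => ρ) / n) atTop (𝓝 0) := by
  let P : Measure (ℕ → Ω) := Measure.infinitePi fun _ => ρ
  have hev : ∀ i, P.map (fun ω => ω i) = ρ := fun i => Measure.infinitePi_map_eval _ i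
  have hmp : ∀ i, MeasurePreserving (fun ω : ℕ → Ω => ω i) P ρ := fun i =>
    ⟨measurable_pi_apply i, hev i⟩
  have hind : iIndepFun (fun (i : ℕ) (ω : ℕ → Ω) => ω i) P :=
    iIndepFun_infinitePi (X := fun _ x => x) fun _ => measurable_id
  have h0 : ∫ ω, f (ω 0) ∂P = ∫ x, f x ∂ρ := by
    rw [← hev 0, integral_map (measurable_pi_apply 0).aemeasurable hf.aestronglyMeasurable]
  have h := strong_law_Lp (μ := P) le_rfl ENNReal.one_ne_top (fun i ω => f (ω i))
    (memLp_one_iff_integrable.2 ((hmp 0).integrable_comp_of_integrable hi))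
    (fun i j hij => (hind.comp (fun _ => f) fun _ => hf).indepFun hij)
    (fun i => ⟨(hf.comp (measurable_pi_apply i)).aemeasurable,
      (hf.comp (measurable_pi_apply 0)).aemeasurable, by
        rw [← Function.comp_def f, ← Function.comp_def f,
          ← Measure.map_map hf (measurable_pi_apply i),
          ← Measure.map_map hf (measurable_pi_apply 0), hev i, hev 0]⟩)
  refine h.congr' ?_
  filter_upwards [eventually_ge_atTop 1] with n hn
  have hn0 : (n : ℝ) ≠ 0 := by positivity
  have hpi : P.map (fun ω (t : Fin n) => ω t) = Measure.pi fun _ : Fin n => ρ := by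
    have h1 : iIndepFun (fun (t : Fin n) (ω : ℕ → Ω) => ω t) P := hind.precomp Fin.val_injective
    rw [(iIndepFun_iff_map_fun_eq_pi_map
      fun t : Fin n => (measurable_pi_apply (t : ℕ)).aemeasurable).1 h1]
    simp only [hev]
  rw [eLpNorm_one_eq_lintegral_enorm, ← hpi, lintegral_map (by fun_prop) (by fun_prop),
    ENNReal.div_eq_inv_mul, ← lintegral_const_mul _ (by fun_prop), h0]
  refine lintegral_congr fun ω => ?_
  rw [← Fin.sum_univ_eq_sum_range (fun i => f (ω i)), smul_eq_mul]
  have : (n : ℝ)⁻¹ * ∑ t : Fin n, f (ω t) - ∫ x, f x ∂ρ =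
      (n : ℝ)⁻¹ * (∑ t : Fin n, f (ω t) - n * ∫ x, f x ∂ρ) := by field_simp
  rw [this, enorm_mul, enorm_inv hn0]
  simp

theorem lintegral_sum_sub_integral_ne_top {Ω : Type*} [MeasurableSpace Ω] (ρ : Measure Ω)
    [IsProbabilityMeasure ρ] (f : Ω → ℝ) (hi : Integrable f ρ) (n : ℕ) (a : ℝ) :
    ∫⁻ ω, ‖∑ t, f (ω t) - a‖ₑ ∂(Measure.pi fun _ : Fin n => ρ) ≠ ∞ := by
  have : Integrable (fun ω : Fin n → Ω => ∑ t, f (ω t) - a) (Measure.pi fun _ : Fin n => ρ) :=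
    (integrable_finsetSum _ fun t _ =>
      (measurePreserving_eval (fun _ : Fin n => ρ) t).integrable_comp_of_integrable hi).sub
      (integrable_const _)
  exact this.2.ne

section InfoDensity

variable {𝓧 𝓩 : Type*} [MeasurableSpace 𝓧] [MeasurableSpace 𝓩]
  {p : Measure 𝓧} {W : Kernel 𝓧 𝓩}

theorem compProd_ac_of_mutualInfo_ne_top [IsProbabilityMeasure p] [IsMarkovKernel W]
    (h : mutualInfo (p ⊗ₘ W) ≠ ∞) :
    p ⊗ₘ W ≪ p.prod (p ⊗ₘ W).snd ∧
      Integrable (llr (p ⊗ₘ W) (p.prod (p ⊗ₘ W).snd)) (p ⊗ₘ W) := by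
  have h1 : klDiv (p ⊗ₘ W) ((p ⊗ₘ W).fst.prod (p ⊗ₘ W).snd) ≠ ∞ := fun h2 => h <| by
    rw [mutualInfo, h2, ENNReal.top_div_of_ne_top ENNReal.ofReal_ne_top]
  rw [Measure.fst_compProd] at h1
  exact klDiv_ne_top_iff.1 h1

variable [MeasurableSpace.CountableOrCountablyGenerated 𝓧 𝓩]

/-- The density of the joint law `p ⊗ₘ W` of input and output with respect to the product of its
marginals. It is the Radon-Nikodym derivative of the kernel `W`, so that for almost every input `x`
it is at the same time the density of `W x` with respect to the output law. Its values are in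
`ℝ≥0`: the value `∞` is replaced by `0`, which changes it on a null set only. -/
def infoDensity (p : Measure 𝓧) (W : Kernel 𝓧 𝓩) (y : 𝓧 × 𝓩) : ℝ≥0 :=
  (W.rnDeriv (Kernel.const 𝓧 (p ⊗ₘ W).snd) y.1 y.2).toNNReal

@[fun_prop]
theorem measurable_infoDensity (p : Measure 𝓧) (W : Kernel 𝓧 𝓩) : Measurable (infoDensity p W) :=
  (Kernel.measurable_rnDeriv _ _).ennreal_toNNReal

variable [IsProbabilityMeasure p] [IsMarkovKernel W]

theorem ae_eq_withDensity_infoDensity (h : mutualInfo (p ⊗ₘ W) ≠ ∞) :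
    ∀ᵐ x ∂p, W x = (p ⊗ₘ W).snd.withDensity fun z => (infoDensity p W (x, z) : ℝ≥0∞) := by
  have hac := Measure.AbsolutelyContinuous.kernel_of_compProd
    (κ := W) (η := Kernel.const 𝓧 (p ⊗ₘ W).snd) (μ := p) (ν := p) (by
      rw [Measure.compProd_const]
      exact (compProd_ac_of_mutualInfo_ne_top h).1)
  filter_upwards [hac] with x hx
  conv_lhs => rw [← Kernel.withDensity_rnDeriv_eq hx,
    Kernel.withDensity_apply _ (Kernel.measurable_rnDeriv _ _)]
  refine withDensity_congr_ae ?_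
  filter_upwards [Kernel.rnDeriv_ne_top W (Kernel.const 𝓧 (p ⊗ₘ W).snd) (a := x)] with z hz
  exact (ENNReal.coe_toNNReal hz).symm

theorem compProd_eq_withDensity_infoDensity (h : mutualInfo (p ⊗ₘ W) ≠ ∞) :
    p ⊗ₘ W = (p.prod (p ⊗ₘ W).snd).withDensity fun y => (infoDensity p W y : ℝ≥0∞) := by
  ext s hs
  rw [Measure.compProd_apply hs, withDensity_apply _ hs, ← lintegral_indicator hs,
    lintegral_prod _ (by fun_prop)]
  refine lintegral_congr_ae ?_
  filter_upwards [ae_eq_withDensity_infoDensity h] with x hx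
  conv_lhs => rw [hx]
  rw [withDensity_apply _ (measurable_prodMk_left hs),
    ← lintegral_indicator (measurable_prodMk_left hs)]
  rfl

theorem llr_ae_eq_log_infoDensity (h : mutualInfo (p ⊗ₘ W) ≠ ∞) :
    llr (p ⊗ₘ W) (p.prod (p ⊗ₘ W).snd) =ᵐ[p ⊗ₘ W] fun y => Real.log (infoDensity p W y) := by
  have h1 : (p ⊗ₘ W).rnDeriv (p.prod (p ⊗ₘ W).snd) =ᵐ[p.prod (p ⊗ₘ W).snd]
      fun y => (infoDensity p W y : ℝ≥0∞) := by
    have h2 := Measure.rnDeriv_withDensity (p.prod (p ⊗ₘ W).snd)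
      (measurable_infoDensity p W).coe_nnreal_ennreal
    rwa [← compProd_eq_withDensity_infoDensity h] at h2
  filter_upwards [(compProd_ac_of_mutualInfo_ne_top h).1.ae_le h1] with y hy
  rw [llr, hy, ENNReal.coe_toReal]

theorem integrable_log_infoDensity (h : mutualInfo (p ⊗ₘ W) ≠ ∞) :
    Integrable (fun y => Real.log (infoDensity p W y)) (p ⊗ₘ W) :=
  (compProd_ac_of_mutualInfo_ne_top h).2.congr (llr_ae_eq_log_infoDensity h)

/-- In nats, the mutual information is the mean of the logarithm of the information density. -/
theorem integral_log_infoDensity (h : mutualInfo (p ⊗ₘ W) ≠ ∞) :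
    ∫ y, Real.log (infoDensity p W y) ∂(p ⊗ₘ W) = (mutualInfo (p ⊗ₘ W)).toReal * Real.log 2 := by
  have h1 := toReal_klDiv_of_measure_eq (compProd_ac_of_mutualInfo_ne_top h).1 (by simp)
  rw [mutualInfo, Measure.fst_compProd, ENNReal.toReal_div,
    ENNReal.toReal_ofReal (Real.log_nonneg one_le_two),
    div_mul_cancel₀ _ (Real.log_pos one_lt_two).ne', h1]
  exact integral_congr_ae (llr_ae_eq_log_infoDensity h).symm

/-- For almost every output, the information density of a random input has mean one. -/
theorem ae_lintegral_infoDensity (h : mutualInfo (p ⊗ₘ W) ≠ ∞) :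
    ∀ᵐ z ∂(p ⊗ₘ W).snd, ∫⁻ x, (infoDensity p W (x, z) : ℝ≥0∞) ∂p = 1 := by
  have hm : Measurable fun y => (infoDensity p W y : ℝ≥0∞) := by fun_prop
  refine ae_eq_of_forall_setLIntegral_eq_of_sigmaFinite hm.lintegral_prod_left'
    measurable_const fun s hs _ => ?_
  have h1 : (p ⊗ₘ W).snd s = ∫⁻ z in s, ∫⁻ x, (infoDensity p W (x, z) : ℝ≥0∞) ∂p
      ∂(p ⊗ₘ W).snd := by
    conv_lhs => rw [Measure.snd_apply hs, compProd_eq_withDensity_infoDensity h,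
      withDensity_apply _ (measurable_snd hs)]
    rw [← Set.univ_prod, ← Measure.prod_restrict, Measure.restrict_univ,
      lintegral_prod_symm' _ hm]
  rw [← h1]
  simp

/-- Under independent uses of the input and the output law, reweighting by the product of the
information densities gives the law of `n` independent input-output pairs. -/
theorem lintegral_lintegral_prod_infoDensity_mul (h : mutualInfo (p ⊗ₘ W) ≠ ∞) (n : ℕ)
    (G : (Fin n → 𝓧 × 𝓩) → ℝ≥0∞) (hG : Measurable G) :
    ∫⁻ z, ∫⁻ x, (∏ t, (infoDensity p W (x t, z t) : ℝ≥0∞)) * G (fun t => (x t, z t))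
        ∂(Measure.pi fun _ : Fin n => p) ∂(Measure.pi fun _ : Fin n => (p ⊗ₘ W).snd) =
      ∫⁻ ω, G ω ∂(Measure.pi fun _ : Fin n => p ⊗ₘ W) := by
  have hw := compProd_eq_withDensity_infoDensity h
  set ν := (p ⊗ₘ W).snd
  have : SigmaFinite ((p.prod ν).withDensity fun y => (infoDensity p W y : ℝ≥0∞)) :=
    hw ▸ inferInstance
  have h1 : (Measure.pi fun _ : Fin n => p ⊗ₘ W) =
      (Measure.pi fun _ : Fin n => p.prod ν).withDensity
        fun ω => ∏ t, (infoDensity p W (ω t) : ℝ≥0∞) := by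
    rw [hw]
    exact pi_withDensity (fun _ : Fin n => p.prod ν) _ fun _ => by fun_prop
  rw [h1, lintegral_withDensity_eq_lintegral_mul _ (by fun_prop) hG,
    ← lintegral_prod_symm' (μ := Measure.pi fun _ : Fin n => p)
      (ν := Measure.pi fun _ : Fin n => ν)
      (fun y : (Fin n → 𝓧) × (Fin n → 𝓩) => (∏ t, (infoDensity p W (y.1 t, y.2 t) : ℝ≥0∞)) *
        G (fun t => (y.1 t, y.2 t))) (by fun_prop),
    ← (measurePreserving_arrowProdEquivProdArrow 𝓧 𝓩 (Fin n)
      (fun _ => p) (fun _ => ν)).lintegral_comp (by fun_prop)]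
  rfl

end InfoDensity

/-! ### The joint law of the secret message and of the observation -/

section Leakage

variable {𝓧 𝓩 : Type*} [MeasurableSpace 𝓧] [MeasurableSpace 𝓩] {K M n A : ℕ}
  {B : Fin K → ℕ} (W : Fin K → Fin M → Kernel 𝓧 𝓩)
  (k' : Fin K) (m' : Fin M)

/-- The joint law of the secret message and of what Eve receives, for the code `c`. -/
def receivedLaw (c : HarqCode 𝓧 M n A B) : Measure (Fin A × (SlotsUpTo k' m' → Fin n → 𝓩)) :=
  (indexLaw A B ⊗ₘ eveKernel W k' m' c).map fun ω => (ω.1.1, ω.2)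

variable [∀ k m, IsMarkovKernel (W k m)]

instance (c : HarqCode 𝓧 M n A B) : IsMarkovKernel (eveKernel W k' m' c) := by
  refine ⟨fun ij => ?_⟩
  change IsProbabilityMeasure (Measure.pi fun q : SlotsUpTo k' m' => Measure.pi fun t =>
    W q.1.1 q.1.2 (c q.1.1 (ij.1, ij.2 q.1.1) q.1.2 t))
  infer_instance

theorem receivedLaw_apply (c : HarqCode 𝓧 M n A B)
    {s : Set (Fin A × (SlotsUpTo k' m' → Fin n → 𝓩))} (hs : MeasurableSet s) :
    receivedLaw W k' m' c s =
      ∫⁻ ij, eveKernel W k' m' c ij (Prod.mk ij.1 ⁻¹' s) ∂indexLaw A B := by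
  rw [receivedLaw, Measure.map_apply (by fun_prop) hs,
    Measure.compProd_apply ((show Measurable fun ω : (Fin A × ((k : Fin K) → Fin (B k))) ×
      (SlotsUpTo k' m' → Fin n → 𝓩) => (ω.1.1, ω.2) by fun_prop) hs)]
  rfl

theorem measurable_receivedLaw :
    Measurable fun c : HarqCode 𝓧 M n A B => receivedLaw W k' m' c := by
  refine Measure.measurable_of_measurable_coe _ fun s hs => ?_
  simp_rw [receivedLaw_apply _ _ _ _ hs, lintegral_fintype]
  refine Finset.measurable_sum _ fun ij _ => Measurable.mul_const ?_ _
  refine (Measure.measurable_coe (measurable_prodMk_left hs)).comp ?_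
  refine measurable_measure_pi _ fun q => measurable_measure_pi _ fun t => ?_
  exact (W q.1.1 q.1.2).measurable.comp (by fun_prop)

variable [∀ k, NeZero (B k)]

instance [NeZero A] : IsProbabilityMeasure (indexLaw A B) := by
  unfold indexLaw
  infer_instance

instance [NeZero A] (c : HarqCode 𝓧 M n A B) :
    IsProbabilityMeasure (receivedLaw W k' m' c) :=
  Measure.isProbabilityMeasure_map (by fun_prop)

theorem fst_receivedLaw (c : HarqCode 𝓧 M n A B) :
    (receivedLaw W k' m' c).fst = uniformOn Set.univ := by
  ext s hs
  rw [Measure.fst_apply hs, receivedLaw_apply _ _ _ _ (measurable_fst hs)]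
  have h : ∀ ij : Fin A × ((k : Fin K) → Fin (B k)),
      eveKernel W k' m' c ij (Prod.mk ij.1 ⁻¹' (Prod.fst ⁻¹' s)) =
        (Prod.fst ⁻¹' s).indicator 1 ij := fun ij => by
    by_cases hi : ij.1 ∈ s
    · simp [Set.preimage_preimage, hi]
    · simp [Set.preimage_preimage, hi]
  simp_rw [h]
  rw [lintegral_indicator_one (measurable_fst hs), ← Measure.fst_apply hs, indexLaw,
    Measure.fst_prod]

variable [NeZero A]

theorem measurable_leakage [StandardBorelSpace 𝓩] :
    Measurable fun c : HarqCode 𝓧 M n A B => leakage W k' m' c := by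
  let κ : Kernel (HarqCode 𝓧 M n A B) (Fin A × (SlotsUpTo k' m' → Fin n → 𝓩)) :=
    ⟨receivedLaw W k' m', measurable_receivedLaw W k' m'⟩
  have hκ : IsMarkovKernel κ := ⟨fun c => inferInstanceAs
    (IsProbabilityMeasure (receivedLaw W k' m' c))⟩
  -- The product of the marginals of `κ c` is the value at `c` of the kernel `κ.fst ×ₖ κ.snd`.
  have h := measurable_klDiv_kernel κ (κ.fst ×ₖ κ.snd)
  simp only [Kernel.prod_apply, Kernel.fst_apply, Kernel.snd_apply] at h
  exact h.div_const _

theorem leakage_le (c : HarqCode 𝓧 M n A B) (Q : Measure (SlotsUpTo k' m' → Fin n → 𝓩))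
    [IsProbabilityMeasure Q] :
    leakage W k' m' c ≤
      klDiv (receivedLaw W k' m' c) ((uniformOn Set.univ).prod Q) /
        ENNReal.ofReal (Real.log 2) := by
  have h := klDiv_fst_prod_snd_le (receivedLaw W k' m' c) Q
  rw [fst_receivedLaw] at h
  rw [leakage, mutualInfo]
  change klDiv (receivedLaw W k' m' c)
    ((receivedLaw W k' m' c).fst.prod (receivedLaw W k' m' c).snd) / _ ≤ _
  rw [fst_receivedLaw]
  gcongr

end Leakage

/-! ### Soft covering at a fixed observation -/

section Covering

variable {𝓦 ι : Type*} [MeasurableSpace 𝓦] [Fintype ι] (μ : Measure 𝓦) [IsProbabilityMeasure μ]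
  (φ : 𝓦 → ℝ≥0)

theorem lintegral_average_pi (hφ : Measurable φ) (h1 : ∫⁻ x, φ x ∂μ = 1) {B : ℕ} [NeZero B]
    (e : Fin B → ι) :
    ∫⁻ c, ((B : ℝ≥0)⁻¹ * ∑ b, φ (c (e b)) : ℝ≥0) ∂(Measure.pi fun _ : ι => μ) = 1 := by
  have h2 : ∀ b, ∫⁻ c, (φ (c (e b)) : ℝ≥0∞) ∂(Measure.pi fun _ : ι => μ) = 1 := fun b => by
    rw [← h1]
    exact (measurePreserving_eval (fun _ : ι => μ) (e b)).lintegral_comp hφ.coe_nnreal_ennreal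
  push_cast [NeZero.ne B]
  rw [lintegral_const_mul _ (by fun_prop), lintegral_finsetSum _ (by fun_prop)]
  simp only [h2]
  simp [ENNReal.inv_mul_cancel, NeZero.ne B]

/-- With `g` the average of the `x b`, the left side is `g log (1 + g)`. In each of its summands
`x b * log1p g`, the own term `x b / B` of the average is separated from the others. -/
theorem average_mul_log1p_le {B : ℕ} (x : Fin B → ℝ≥0) :
    ((B : ℝ≥0)⁻¹ * ∑ b, x b) * log1p ((B : ℝ≥0)⁻¹ * ∑ b, x b) ≤
      (B : ℝ≥0)⁻¹ * ∑ b, x b * log1p (x b / B) +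
        (B : ℝ≥0)⁻¹ * ((B : ℝ≥0)⁻¹ * ∑ b, ∑ b' ∈ Finset.univ.erase b, x b * x b') := by
  rw [mul_assoc, ← mul_add, Finset.mul_sum _ _ (B : ℝ≥0)⁻¹, ← Finset.mul_sum _ _ (B : ℝ≥0)⁻¹,
    Finset.mul_sum _ (fun b => ∑ b' ∈ Finset.univ.erase b, x b * x b'),
    ← Finset.sum_add_distrib, Finset.sum_mul]
  gcongr with b
  have h : (B : ℝ≥0)⁻¹ * ∑ b, x b =
      x b / B + (B : ℝ≥0)⁻¹ * ∑ b' ∈ Finset.univ.erase b, x b' := by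
    rw [← Finset.add_sum_erase _ _ (Finset.mem_univ b)]
    ring
  calc x b * log1p ((B : ℝ≥0)⁻¹ * ∑ b, x b)
      ≤ x b * (log1p (x b / B) + (B : ℝ≥0)⁻¹ * ∑ b' ∈ Finset.univ.erase b, x b') := by
        rw [h]
        gcongr
        exact log1p_add_le _ _
    _ = _ := by
        rw [← Finset.mul_sum]
        ring

/-- Soft covering for a random codebook: the words `c (e b)` are independent with law `μ`, and
`φ` is the density, at the given observation, of the output for a given word. The products of the
densities of two different words have mean one, and contribute at most the summand `1`. -/
theorem lintegral_average_mul_log1p_le (hφ : Measurable φ) (h1 : ∫⁻ x, φ x ∂μ = 1) {B : ℕ}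
    [NeZero B] (e : Fin B → ι) (he : Function.Injective e) :
    ∫⁻ c, (((B : ℝ≥0)⁻¹ * ∑ b, φ (c (e b))) * log1p ((B : ℝ≥0)⁻¹ * ∑ b, φ (c (e b))) : ℝ≥0)
        ∂(Measure.pi fun _ : ι => μ) ≤
      ∫⁻ x, (φ x * log1p (φ x / B) : ℝ≥0) ∂μ + 1 := by
  have hB : (B : ℝ≥0∞) ≠ 0 := by simpa using NeZero.ne B
  have h2 : ∀ b, ∫⁻ c, ((φ (c (e b)) * log1p (φ (c (e b)) / B) : ℝ≥0) : ℝ≥0∞)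
      ∂(Measure.pi fun _ : ι => μ) = ∫⁻ x, (φ x * log1p (φ x / B) : ℝ≥0) ∂μ := fun b =>
    (measurePreserving_eval (fun _ : ι => μ) (e b)).lintegral_comp
      (f := fun x => ((φ x * log1p (φ x / B) : ℝ≥0) : ℝ≥0∞)) (by fun_prop)
  have h3 : ∀ b, ∀ b' ∈ Finset.univ.erase b,
      ∫⁻ c, ((φ (c (e b)) * φ (c (e b')) : ℝ≥0) : ℝ≥0∞) ∂(Measure.pi fun _ : ι => μ) = 1 := by
    intro b b' hb
    have h := lintegral_pi_prod_comp (fun _ : ι => μ) {b, b'} e he.injOn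
      (fun _ x => (φ x : ℝ≥0∞)) fun _ => hφ.coe_nnreal_ennreal
    have hbb : b ≠ b' := (Finset.ne_of_mem_erase hb).symm
    simp only [Finset.prod_pair hbb, h1, mul_one] at h
    simpa using h
  calc _ ≤ ∫⁻ c, (((B : ℝ≥0)⁻¹ * ∑ b, φ (c (e b)) * log1p (φ (c (e b)) / B) +
        (B : ℝ≥0)⁻¹ * ((B : ℝ≥0)⁻¹ * ∑ b, ∑ b' ∈ Finset.univ.erase b,
          φ (c (e b)) * φ (c (e b'))) : ℝ≥0) : ℝ≥0∞) ∂(Measure.pi fun _ : ι => μ) :=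
        lintegral_mono fun c => ENNReal.coe_le_coe.2 (average_mul_log1p_le fun b => φ (c (e b)))
    _ = (B : ℝ≥0∞)⁻¹ * ∑ b : Fin B, ∫⁻ x, (φ x * log1p (φ x / B) : ℝ≥0) ∂μ +
        (B : ℝ≥0∞)⁻¹ * ((B : ℝ≥0∞)⁻¹ * ∑ b : Fin B, ∑ b' ∈ Finset.univ.erase b, 1) := by
        simp only [ENNReal.coe_add]
        rw [lintegral_add_left (by fun_prop)]
        simp only [ENNReal.coe_mul (B : ℝ≥0)⁻¹, ENNReal.ofNNReal_finsetSum,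
          ENNReal.coe_inv (show (B : ℝ≥0) ≠ 0 by simpa using NeZero.ne B), ENNReal.coe_natCast]
        rw [lintegral_const_mul _ (by fun_prop), lintegral_const_mul _ (by fun_prop),
          lintegral_const_mul _ (by fun_prop), lintegral_finsetSum _ (by fun_prop),
          lintegral_finsetSum _ (by fun_prop)]
        simp only [h2]
        congr 3
        refine Finset.sum_congr rfl fun b _ => ?_
        rw [lintegral_finsetSum _ (by fun_prop)]
        exact Finset.sum_congr rfl (h3 b)
    _ ≤ _ := by
        have h4 : ∀ b : Fin B, ∑ b' ∈ Finset.univ.erase b, (1 : ℝ≥0∞) ≤ B := fun b => by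
          calc ∑ b' ∈ Finset.univ.erase b, (1 : ℝ≥0∞) ≤ ∑ b' : Fin B, 1 :=
                Finset.sum_le_sum_of_subset (Finset.erase_subset _ _)
            _ = B := by simp
        have h5 : ∀ y : ℝ≥0∞, (B : ℝ≥0∞)⁻¹ * (B * y) = y := fun y => by
          rw [← mul_assoc, ENNReal.inv_mul_cancel hB (by simp), one_mul]
        gcongr
        · simp [h5]
        · calc (B : ℝ≥0∞)⁻¹ * ((B : ℝ≥0∞)⁻¹ * ∑ b : Fin B, ∑ b' ∈ Finset.univ.erase b, 1)
              ≤ (B : ℝ≥0∞)⁻¹ * ((B : ℝ≥0∞)⁻¹ * ∑ b : Fin B, (B : ℝ≥0∞)) := by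
                gcongr with b
                exact h4 b
            _ = 1 := by
                simp [h5, ENNReal.inv_mul_cancel hB]

end Covering

/-! ### Densities of codes -/

section Density

variable {𝓧 𝓩 : Type*} [MeasurableSpace 𝓧] [MeasurableSpace 𝓩]
  [MeasurableSpace.CountableOrCountablyGenerated 𝓧 𝓩] {K M n A : ℕ}
  {B : Fin K → ℕ} (pX : Fin K → Measure 𝓧) (W : Fin K → Fin M → Kernel 𝓧 𝓩)
  {k' : Fin K} {m' : Fin M}

/-- The density, with respect to the law of independent output symbols, of what Eve receives in
the slot `q` when the block `x` is sent. -/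
def slotDensity (q : SlotsUpTo k' m') (x : Fin n → 𝓧) (z : Fin n → 𝓩) : ℝ≥0 :=
  ∏ t, infoDensity (pX q.1.1) (W q.1.1 q.1.2) (x t, z t)

/-- The density, with respect to `outputLaw`, of what Eve receives in those slots of frame `k` that
are observed, when the word `x` is sent. It is `1` for a frame without such a slot. -/
def wordDensity (k : Fin K) (x : Fin M → Fin n → 𝓧) (z : SlotsUpTo k' m' → Fin n → 𝓩) : ℝ≥0 :=
  ∏ q with q.1.1 = k, slotDensity pX W q (x q.1.2) (z q)

/-- The average of the word densities over the random messages of frame `k`, for the secret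
message `i`. -/
def frameDensity (k : Fin K) (c : FrameCode 𝓧 M n A (B k)) (i : Fin A)
    (z : SlotsUpTo k' m' → Fin n → 𝓩) : ℝ≥0 :=
  (B k : ℝ≥0)⁻¹ * ∑ b, wordDensity pX W k (c (i, b)) z

/-- The density of the joint law of secret message and observation with respect to the product of
the uniform law and `outputLaw`, see `receivedLaw_eq_withDensity`. -/
def codeDensity (c : HarqCode 𝓧 M n A B) (y : Fin A × (SlotsUpTo k' m' → Fin n → 𝓩)) : ℝ≥0 :=
  ∏ k, frameDensity pX W k (c k) y.1 y.2

variable (n k' m') in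
/-- The law of the observation for which all the received symbols are independent, those of each
slot having the output law of its channel. -/
def outputLaw : Measure (SlotsUpTo k' m' → Fin n → 𝓩) :=
  Measure.pi fun q => Measure.pi fun _ => (pX q.1.1 ⊗ₘ W q.1.1 q.1.2).snd

@[fun_prop]
theorem measurable_slotDensity (q : SlotsUpTo k' m') :
    Measurable fun y : (Fin n → 𝓧) × (Fin n → 𝓩) => slotDensity pX W q y.1 y.2 := by
  unfold slotDensity
  fun_prop

@[fun_prop]
theorem measurable_wordDensity (k : Fin K) :
    Measurable fun y : (Fin M → Fin n → 𝓧) × (SlotsUpTo k' m' → Fin n → 𝓩) =>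
      wordDensity pX W k y.1 y.2 := by
  unfold wordDensity
  refine Finset.measurable_prod _ fun q _ => ?_
  exact (measurable_slotDensity pX W q).comp
    (f := fun y : (Fin M → Fin n → 𝓧) × (SlotsUpTo k' m' → Fin n → 𝓩) => (y.1 q.1.2, y.2 q))
    (by fun_prop)

@[fun_prop]
theorem measurable_frameDensity (k : Fin K) (i : Fin A) :
    Measurable fun y : FrameCode 𝓧 M n A (B k) × (SlotsUpTo k' m' → Fin n → 𝓩) =>
      frameDensity pX W k y.1 i y.2 := by
  unfold frameDensity
  refine Measurable.const_mul (Finset.measurable_sum _ fun b _ => ?_) _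
  exact (measurable_wordDensity pX W k).comp
    (f := fun y : FrameCode 𝓧 M n A (B k) × (SlotsUpTo k' m' → Fin n → 𝓩) => (y.1 (i, b), y.2))
    (by fun_prop)

theorem measurable_codeDensity_apply (i : Fin A) :
    Measurable fun y : HarqCode 𝓧 M n A B × (SlotsUpTo k' m' → Fin n → 𝓩) =>
      codeDensity pX W y.1 (i, y.2) := by
  unfold codeDensity
  refine Finset.measurable_prod _ fun k _ => ?_
  exact (measurable_frameDensity pX W k i).comp
    (f := fun y : HarqCode 𝓧 M n A B × (SlotsUpTo k' m' → Fin n → 𝓩) => (y.1 k, y.2))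
    (by fun_prop)

@[fun_prop]
theorem measurable_codeDensity :
    Measurable fun y : HarqCode 𝓧 M n A B × (Fin A × (SlotsUpTo k' m' → Fin n → 𝓩)) =>
      codeDensity pX W y.1 y.2 := by
  have h : Measurable fun y : Fin A × (HarqCode 𝓧 M n A B × (SlotsUpTo k' m' → Fin n → 𝓩)) =>
      codeDensity pX W y.2.1 (y.1, y.2.2) :=
    measurable_from_prod_countable_right fun i => measurable_codeDensity_apply pX W i
  exact h.comp (g := fun y : Fin A × (HarqCode 𝓧 M n A B × (SlotsUpTo k' m' → Fin n → 𝓩)) =>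
      codeDensity pX W y.2.1 (y.1, y.2.2))
    (f := fun y : HarqCode 𝓧 M n A B × (Fin A × (SlotsUpTo k' m' → Fin n → 𝓩)) =>
      (y.2.1, y.1, y.2.2)) (by fun_prop)

theorem lintegral_uniformOn_univ {B : ℕ} [NeZero B] (f : Fin B → ℝ≥0) :
    ∫⁻ b, (f b : ℝ≥0∞) ∂uniformOn Set.univ = ((B : ℝ≥0)⁻¹ * ∑ b, f b : ℝ≥0) := by
  have h : ∀ b : Fin B, (uniformOn Set.univ : Measure (Fin B)) {b} = (B : ℝ≥0∞)⁻¹ := fun b => by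
    rw [uniformOn_univ]
    simp
  rw [lintegral_fintype]
  simp only [h]
  push_cast [NeZero.ne B]
  rw [← Finset.sum_mul, mul_comm]

variable [∀ k, IsProbabilityMeasure (pX k)] [∀ k m, IsMarkovKernel (W k m)]

instance : IsProbabilityMeasure (outputLaw n pX W k' m') := by
  unfold outputLaw
  infer_instance

theorem eveKernel_eq_withDensity (c : HarqCode 𝓧 M n A B) (hc : ∀ q : SlotsUpTo k' m', ∀ ab t,
      W q.1.1 q.1.2 (c q.1.1 ab q.1.2 t) = (pX q.1.1 ⊗ₘ W q.1.1 q.1.2).snd.withDensity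
        fun z => (infoDensity (pX q.1.1) (W q.1.1 q.1.2) (c q.1.1 ab q.1.2 t, z) : ℝ≥0∞))
    (ij : Fin A × ((k : Fin K) → Fin (B k))) :
    eveKernel W k' m' c ij = (outputLaw n pX W k' m').withDensity fun z =>
      ∏ k, (wordDensity pX W k (c k (ij.1, ij.2 k)) z : ℝ≥0∞) := by
  have h1 : ∀ q : SlotsUpTo k' m', (Measure.pi fun t =>
      W q.1.1 q.1.2 (c q.1.1 (ij.1, ij.2 q.1.1) q.1.2 t)) =
      (Measure.pi fun _ => (pX q.1.1 ⊗ₘ W q.1.1 q.1.2).snd).withDensity fun z =>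
        (slotDensity pX W q (c q.1.1 (ij.1, ij.2 q.1.1) q.1.2) z : ℝ≥0∞) := fun q => by
    have : ∀ t, SigmaFinite ((pX q.1.1 ⊗ₘ W q.1.1 q.1.2).snd.withDensity fun z =>
        (infoDensity (pX q.1.1) (W q.1.1 q.1.2)
          (c q.1.1 (ij.1, ij.2 q.1.1) q.1.2 t, z) : ℝ≥0∞)) := fun t => by
      rw [← hc]
      infer_instance
    simp_rw [hc q]
    rw [pi_withDensity (fun _ : Fin n => (pX q.1.1 ⊗ₘ W q.1.1 q.1.2).snd) _
      fun t => by fun_prop]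
    simp [slotDensity]
  have h2 : ∀ q : SlotsUpTo k' m', SigmaFinite ((Measure.pi fun _ =>
      (pX q.1.1 ⊗ₘ W q.1.1 q.1.2).snd).withDensity fun z =>
        (slotDensity pX W q (c q.1.1 (ij.1, ij.2 q.1.1) q.1.2) z : ℝ≥0∞)) := fun q => by
    rw [← h1]
    infer_instance
  change (Measure.pi fun q : SlotsUpTo k' m' => Measure.pi fun t =>
      W q.1.1 q.1.2 (c q.1.1 (ij.1, ij.2 q.1.1) q.1.2 t)) = _
  simp_rw [h1]
  rw [pi_withDensity (fun q : SlotsUpTo k' m' => Measure.pi fun _ : Fin n =>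
    (pX q.1.1 ⊗ₘ W q.1.1 q.1.2).snd) _ fun q => by fun_prop, outputLaw]
  congr 1
  ext z
  rw [← Finset.prod_fiberwise Finset.univ (fun q : SlotsUpTo k' m' => q.1.1)]
  refine Finset.prod_congr rfl fun k _ => ?_
  rw [wordDensity, ENNReal.ofNNReal_finsetProd]
  refine Finset.prod_congr rfl fun q hq => ?_
  obtain rfl := (Finset.mem_filter.1 hq).2
  rfl

/-- The index law makes the random messages independent, hence the average over them of the
product of the word densities is the product of the frame densities. -/
theorem receivedLaw_eq_withDensity [NeZero A] [∀ k, NeZero (B k)]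
    (c : HarqCode 𝓧 M n A B) (hc : ∀ q : SlotsUpTo k' m', ∀ ab t,
      W q.1.1 q.1.2 (c q.1.1 ab q.1.2 t) = (pX q.1.1 ⊗ₘ W q.1.1 q.1.2).snd.withDensity
        fun z => (infoDensity (pX q.1.1) (W q.1.1 q.1.2) (c q.1.1 ab q.1.2 t, z) : ℝ≥0∞)) :
    receivedLaw W k' m' c = ((uniformOn Set.univ).prod (outputLaw n pX W k' m')).withDensity
      fun y => (codeDensity pX W c y : ℝ≥0∞) := by
  have hm : Measurable fun y : Fin A × (SlotsUpTo k' m' → Fin n → 𝓩) =>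
      (codeDensity pX W c y : ℝ≥0∞) := by fun_prop
  ext s hs
  rw [receivedLaw_apply _ _ _ _ hs, withDensity_apply _ hs, ← lintegral_indicator hs,
    lintegral_prod _ (hm.indicator hs).aemeasurable, indexLaw,
    lintegral_prod _ (measurable_of_countable _).aemeasurable]
  refine lintegral_congr fun i => ?_
  have hsi : MeasurableSet (Prod.mk i ⁻¹' s) := measurable_prodMk_left hs
  simp_rw [eveKernel_eq_withDensity pX W c hc]
  have h1 : ∀ z : SlotsUpTo k' m' → Fin n → 𝓩,
      s.indicator (fun y => (codeDensity pX W c y : ℝ≥0∞)) (i, z) =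
      (Prod.mk i ⁻¹' s).indicator (fun z =>
        ∫⁻ j, ∏ k, (wordDensity pX W k (c k (i, j k)) z : ℝ≥0∞)
          ∂Measure.pi fun _ => uniformOn Set.univ) z := by
    intro z
    have h2 := lintegral_pi_prod_comp (fun k => (uniformOn Set.univ : Measure (Fin (B k))))
      Finset.univ id (Set.injOn_id _) (fun k b => (wordDensity pX W k (c k (i, b)) z : ℝ≥0∞))
      fun k => measurable_of_countable _
    simp only [id, lintegral_uniformOn_univ] at h2
    by_cases hz : (i, z) ∈ s
    · rw [Set.indicator_of_mem hz, Set.indicator_of_mem (show z ∈ Prod.mk i ⁻¹' s from hz), h2,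
        codeDensity, ENNReal.ofNNReal_finsetProd]
      rfl
    · rw [Set.indicator_of_notMem hz, Set.indicator_of_notMem (show z ∉ Prod.mk i ⁻¹' s from hz)]
  simp_rw [h1]
  rw [lintegral_indicator hsi, lintegral_lintegral_swap]
  · refine lintegral_congr fun j => ?_
    rw [withDensity_apply _ hsi]
  · refine Measurable.aemeasurable (measurable_from_prod_countable_left fun j => ?_)
    exact Finset.measurable_prod _ fun k _ =>
      ((measurable_wordDensity pX W k).comp
        (f := fun z => (c k (i, j k), z)) (by fun_prop)).coe_nnreal_ennreal

/-- Almost every code satisfies the hypothesis of `receivedLaw_eq_withDensity`: the channel laws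
at all its symbols have the information density as their density. -/
theorem ae_codeLaw (hI : ∀ q : SlotsUpTo k' m', mutualInfo (pX q.1.1 ⊗ₘ W q.1.1 q.1.2) ≠ ∞) :
    ∀ᵐ c ∂codeLaw M n A B pX, ∀ q : SlotsUpTo k' m', ∀ ab t,
      W q.1.1 q.1.2 (c q.1.1 ab q.1.2 t) = (pX q.1.1 ⊗ₘ W q.1.1 q.1.2).snd.withDensity
        fun z => (infoDensity (pX q.1.1) (W q.1.1 q.1.2) (c q.1.1 ab q.1.2 t, z) : ℝ≥0∞) := by
  simp only [ae_all_iff]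
  intro q ab t
  have h1 := measurePreserving_eval (fun _ : Fin n => pX q.1.1) t
  have h2 := h1.comp (measurePreserving_eval
    (fun _ : Fin M => Measure.pi fun _ : Fin n => pX q.1.1) q.1.2)
  have h3 := h2.comp (measurePreserving_eval (fun _ : Fin A × Fin (B q.1.1) =>
    Measure.pi fun _ : Fin M => Measure.pi fun _ : Fin n => pX q.1.1) ab)
  have h4 := h3.comp (measurePreserving_eval (fun k : Fin K =>
    Measure.pi fun _ : Fin A × Fin (B k) =>
    Measure.pi fun _ : Fin M => Measure.pi fun _ : Fin n => pX k) q.1.1)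
  have h5 : MeasurePreserving (fun c : HarqCode 𝓧 M n A B => c q.1.1 ab q.1.2 t)
    (codeLaw M n A B pX) (pX q.1.1) := h4
  exact h5.quasiMeasurePreserving.ae (ae_eq_withDensity_infoDensity (hI q))

end Density

/-! ### Expectation over the codes at a fixed observation -/

section Expectation

/-- If all factors of a product of functions of independent coordinates have mean one, then the
expectation of the product times a function of one coordinate involves that coordinate only. The
functions `F` are given as a family because the type of the coordinates varies. -/
theorem lintegral_pi_prod_comp_mul {ι κ : Type*} [Fintype ι] [DecidableEq κ] {α : ι → Type*}
    [∀ i, MeasurableSpace (α i)] (μ : ∀ i, Measure (α i)) [∀ i, IsProbabilityMeasure (μ i)]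
    (s : Finset κ) (e : κ → ι) (he : Set.InjOn e s) (f F : ∀ k, α (e k) → ℝ≥0∞)
    (hf : ∀ k, Measurable (f k)) (hF : ∀ k, Measurable (F k))
    (h1 : ∀ k ∈ s, ∫⁻ y, f k y ∂μ (e k) = 1) {k₀ : κ} (hk₀ : k₀ ∈ s) :
    ∫⁻ x, (∏ k ∈ s, f k (x (e k))) * F k₀ (x (e k₀)) ∂Measure.pi μ =
      ∫⁻ y, f k₀ y * F k₀ y ∂μ (e k₀) := by
  have h := lintegral_pi_prod_comp μ s e he
    (fun k y => f k y * if k = k₀ then F k y else 1) fun k => (hf k).mul (by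
      split_ifs
      · exact hF k
      · exact measurable_const)
  rw [← Finset.mul_prod_erase s _ hk₀, Finset.prod_eq_one (s := s.erase k₀), mul_one] at h
  · simp only [if_true] at h
    rw [← h]
    refine lintegral_congr fun x => ?_
    rw [Finset.prod_mul_distrib, Finset.prod_ite_eq' s k₀ (fun k => F k (x (e k))), if_pos hk₀]
  · intro k hk
    simp only [Finset.ne_of_mem_erase hk, if_false, mul_one]
    exact h1 k (Finset.mem_of_mem_erase hk)

/-- In terms of `T = ∑ |log a_k - m_k|`, the hypothesis gives `∏ a_k / B ≤ exp T`, and thus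
`1 + ∏ a_k / B ≤ 2 exp T`. -/
theorem log1p_prod_div_le {κ : Type*} (s : Finset κ) (a : κ → ℝ≥0) (ha : ∀ k ∈ s, a k ≠ 0)
    (m : κ → ℝ) {B : ℕ} [NeZero B] (hB : ∑ k ∈ s, m k ≤ Real.log B) :
    log1p ((∏ k ∈ s, a k) / B) ≤
      (Real.log 2).toNNReal + ∑ k ∈ s, ‖Real.log (a k) - m k‖₊ := by
  have hB0 : (0 : ℝ) < B := by exact_mod_cast Nat.pos_of_ne_zero (NeZero.ne B)
  set T : ℝ := ∑ k ∈ s, ‖Real.log (a k) - m k‖ with hT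
  have hT0 : 0 ≤ T := Finset.sum_nonneg fun _ _ => norm_nonneg _
  have hP : (0 : ℝ) < ∏ k ∈ s, (a k : ℝ) := Finset.prod_pos fun k hk =>
    lt_of_le_of_ne (a k).coe_nonneg fun h => ha k hk (NNReal.coe_eq_zero.1 h.symm)
  have hlog : Real.log ((∏ k ∈ s, (a k : ℝ)) / B) ≤ T := by
    rw [Real.log_div hP.ne' hB0.ne', Real.log_prod fun k hk => NNReal.coe_ne_zero.2 (ha k hk)]
    have : ∑ k ∈ s, (Real.log (a k) - m k) ≤ T :=
      Finset.sum_le_sum fun k _ => Real.le_norm_self _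
    rw [Finset.sum_sub_distrib] at this
    linarith
  have hexp : (∏ k ∈ s, (a k : ℝ)) / B ≤ Real.exp T :=
    (Real.log_le_iff_le_exp (by positivity)).1 hlog
  rw [← NNReal.coe_le_coe, coe_log1p]
  push_cast
  rw [Real.coe_toNNReal _ (Real.log_nonneg one_le_two), ← hT]
  calc Real.log (1 + (∏ k ∈ s, (a k : ℝ)) / B) ≤ Real.log (2 * Real.exp T) := by
        refine Real.log_le_log (by positivity) ?_
        have := Real.one_le_exp hT0
        linarith
    _ = Real.log 2 + T := by
        rw [Real.log_mul two_ne_zero (Real.exp_pos _).ne', Real.log_exp]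

variable {𝓧 𝓩 : Type*} [MeasurableSpace 𝓧] [MeasurableSpace 𝓩]
  [MeasurableSpace.CountableOrCountablyGenerated 𝓧 𝓩] {K M n A : ℕ}
  {B : Fin K → ℕ} (pX : Fin K → Measure 𝓧) (W : Fin K → Fin M → Kernel 𝓧 𝓩)
  {k' : Fin K} {m' : Fin M} [∀ k, IsProbabilityMeasure (pX k)]

theorem injOn_slot (k : Fin K) :
    Set.InjOn (fun q : SlotsUpTo k' m' => q.1.2)
      (Finset.univ.filter fun q : SlotsUpTo k' m' => q.1.1 = k) := by
  intro q hq r hr h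
  simp only [Finset.coe_filter, Finset.mem_univ, true_and, Set.mem_ofPred_eq] at hq hr
  exact Subtype.ext (Prod.ext (hq.trans hr.symm) h)

theorem lintegral_slotDensity (q : SlotsUpTo k' m') (ζ : Fin n → 𝓩)
    (hζ : ∀ t, ∫⁻ x, (infoDensity (pX q.1.1) (W q.1.1 q.1.2) (x, ζ t) : ℝ≥0∞) ∂pX q.1.1 = 1) :
    ∫⁻ x, (slotDensity pX W q x ζ : ℝ≥0∞) ∂(Measure.pi fun _ : Fin n => pX q.1.1) = 1 := by
  have h := lintegral_pi_prod_comp (fun _ : Fin n => pX q.1.1) Finset.univ id (Set.injOn_id _)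
    (fun t x => (infoDensity (pX q.1.1) (W q.1.1 q.1.2) (x, ζ t) : ℝ≥0∞)) fun t => by fun_prop
  simp only [id, hζ, Finset.prod_const_one] at h
  simpa [slotDensity] using h

/-- An observation is regular if, for each of its symbols, the information density of a random
input symbol has mean one. Almost every observation is, see `ae_isRegularOutput`. -/
def IsRegularOutput (z : SlotsUpTo k' m' → Fin n → 𝓩) : Prop :=
  ∀ (q : SlotsUpTo k' m') t,
    ∫⁻ x, (infoDensity (pX q.1.1) (W q.1.1 q.1.2) (x, z q t) : ℝ≥0∞) ∂pX q.1.1 = 1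

variable {pX W} {z : SlotsUpTo k' m' → Fin n → 𝓩}

theorem lintegral_wordDensity_mul (hz : IsRegularOutput pX W z)
    (q₀ : SlotsUpTo k' m') (F : (Fin n → 𝓧) → ℝ≥0∞)
    (hF : Measurable F) :
    ∫⁻ x, (wordDensity pX W q₀.1.1 x z : ℝ≥0∞) * F (x q₀.1.2)
        ∂(Measure.pi fun _ : Fin M => Measure.pi fun _ : Fin n => pX q₀.1.1) =
      ∫⁻ y, (slotDensity pX W q₀ y (z q₀) : ℝ≥0∞) * F y
        ∂(Measure.pi fun _ : Fin n => pX q₀.1.1) := by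
  have h := lintegral_pi_prod_comp_mul
    (fun _ : Fin M => Measure.pi fun _ : Fin n => pX q₀.1.1)
    (Finset.univ.filter fun q : SlotsUpTo k' m' => q.1.1 = q₀.1.1) (fun q => q.1.2)
    (injOn_slot q₀.1.1) (fun q y => (slotDensity pX W q y (z q) : ℝ≥0∞)) (fun _ => F)
    (fun q => by fun_prop) (fun _ => hF) (fun q hq => by
      rw [← (Finset.mem_filter.1 hq).2]
      exact lintegral_slotDensity pX W q (z q) (hz q)) (k₀ := q₀) (by simp)
  rw [← h]
  simp [wordDensity]

theorem lintegral_wordDensity (hz : IsRegularOutput pX W z) (k : Fin K) :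
    ∫⁻ x, (wordDensity pX W k x z : ℝ≥0∞)
      ∂(Measure.pi fun _ : Fin M => Measure.pi fun _ : Fin n => pX k) = 1 := by
  have h := lintegral_pi_prod_comp
    (fun _ : Fin M => Measure.pi fun _ : Fin n => pX k)
    (Finset.univ.filter fun q : SlotsUpTo k' m' => q.1.1 = k) (fun q => q.1.2)
    (injOn_slot k) (fun q y => (slotDensity pX W q y (z q) : ℝ≥0∞)) (fun q => by fun_prop)
  rw [Finset.prod_eq_one fun q hq => ?_] at h
  · simpa [wordDensity] using h
  · rw [← (Finset.mem_filter.1 hq).2]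
    exact lintegral_slotDensity pX W q (z q) (hz q)

theorem lintegral_wordDensity_mul_log1p_le (hz : IsRegularOutput pX W z)
    (k : Fin K) [NeZero (B k)]
    (I : SlotsUpTo k' m' → ℝ)
    (hB : ∑ q : SlotsUpTo k' m' with q.1.1 = k, n * I q ≤ Real.log (B k)) :
    ∫⁻ x, (wordDensity pX W k x z * log1p (wordDensity pX W k x z / B k) : ℝ≥0)
        ∂(Measure.pi fun _ : Fin M => Measure.pi fun _ : Fin n => pX k) ≤
      ENNReal.ofReal (Real.log 2) + ∑ q : SlotsUpTo k' m' with q.1.1 = k,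
        ∫⁻ y, (slotDensity pX W q y (z q) : ℝ≥0∞) *
          ‖∑ t, Real.log (infoDensity (pX q.1.1) (W q.1.1 q.1.2) (y t, z q t)) - n * I q‖ₑ
          ∂(Measure.pi fun _ : Fin n => pX q.1.1) := by
  have hpt : ∀ x : Fin M → Fin n → 𝓧,
      ((wordDensity pX W k x z * log1p (wordDensity pX W k x z / B k) : ℝ≥0) : ℝ≥0∞) ≤
      ENNReal.ofReal (Real.log 2) * wordDensity pX W k x z +
        ∑ q : SlotsUpTo k' m' with q.1.1 = k, (wordDensity pX W k x z : ℝ≥0∞) *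
          ‖∑ t, Real.log (infoDensity (pX q.1.1) (W q.1.1 q.1.2) (x q.1.2 t, z q t)) -
            n * I q‖ₑ := by
    intro x
    -- The logarithms add up only where the density does not vanish; elsewhere both sides are `0`.
    by_cases h0 : wordDensity pX W k x z = 0
    · simp [h0]
    have hq0 : ∀ q ∈ Finset.univ.filter (fun q : SlotsUpTo k' m' => q.1.1 = k),
        slotDensity pX W q (x q.1.2) (z q) ≠ 0 := fun q hq => (Finset.prod_ne_zero_iff.1 h0) q hq
    have h1 := log1p_prod_div_le _ _ hq0 (fun q => n * I q) hB
    have h2 : ∀ q ∈ Finset.univ.filter (fun q : SlotsUpTo k' m' => q.1.1 = k),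
        Real.log (slotDensity pX W q (x q.1.2) (z q)) =
        ∑ t, Real.log (infoDensity (pX q.1.1) (W q.1.1 q.1.2) (x q.1.2 t, z q t)) :=
      fun q hq => by
        have h3 := Finset.prod_ne_zero_iff.1 (hq0 q hq)
        rw [slotDensity, NNReal.coe_prod, Real.log_prod fun t ht => NNReal.coe_ne_zero.2 (h3 t ht)]
    rw [Finset.sum_congr rfl fun q hq => by rw [h2 q hq]] at h1
    calc ((wordDensity pX W k x z * log1p (wordDensity pX W k x z / B k) : ℝ≥0) : ℝ≥0∞)
        ≤ (wordDensity pX W k x z * ((Real.log 2).toNNReal +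
          ∑ q : SlotsUpTo k' m' with q.1.1 = k,
            ‖∑ t, Real.log (infoDensity (pX q.1.1) (W q.1.1 q.1.2) (x q.1.2 t, z q t)) -
              n * I q‖₊) : ℝ≥0) := ENNReal.coe_le_coe.2 (by gcongr; exact h1)
      _ = _ := by
        push_cast
        rw [mul_add, Finset.mul_sum, mul_comm]
        rfl
  have hw : Measurable fun x : Fin M → Fin n → 𝓧 => (wordDensity pX W k x z : ℝ≥0∞) := by
    fun_prop
  refine (lintegral_mono hpt).trans_eq ?_
  rw [lintegral_add_left (hw.const_mul _), lintegral_const_mul _ hw,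
    lintegral_wordDensity hz, mul_one, lintegral_finsetSum _ (by fun_prop)]
  congr 1
  refine Finset.sum_congr rfl fun q hq => ?_
  obtain rfl := (Finset.mem_filter.1 hq).2
  exact lintegral_wordDensity_mul hz q (fun y =>
    ‖∑ t, Real.log (infoDensity (pX q.1.1) (W q.1.1 q.1.2) (y t, z q t)) - n * I q‖ₑ)
    (by fun_prop)

/-- The frames other than `k` integrate out of the term that belongs to frame `k`, to which the
soft-covering bound then applies. -/
theorem lintegral_codeDensity_mul_log1p_le (hz : IsRegularOutput pX W z)
    [∀ k, NeZero (B k)] (i : Fin A) :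
    ∫⁻ c, (codeDensity pX W c (i, z) * log1p (codeDensity pX W c (i, z)) : ℝ≥0)
        ∂codeLaw M n A B pX ≤
      ∑ k, (∫⁻ x, (wordDensity pX W k x z * log1p (wordDensity pX W k x z / B k) : ℝ≥0)
        ∂(Measure.pi fun _ : Fin M => Measure.pi fun _ : Fin n => pX k) + 1) := by
  have hw : ∀ k : Fin K, Measurable fun x : Fin M → Fin n → 𝓧 => wordDensity pX W k x z :=
    fun k => by fun_prop
  have hf : ∀ k : Fin K, Measurable fun c : FrameCode 𝓧 M n A (B k) =>
      frameDensity pX W k c i z := fun k => by fun_prop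
  have hpt : ∀ c : HarqCode 𝓧 M n A B,
      ((codeDensity pX W c (i, z) * log1p (codeDensity pX W c (i, z)) : ℝ≥0) : ℝ≥0∞) ≤
      ∑ k, (∏ l, (frameDensity pX W l (c l) i z : ℝ≥0∞)) *
        log1p (frameDensity pX W k (c k) i z) := by
    intro c
    rw [← Finset.mul_sum, ← ENNReal.ofNNReal_finsetProd, ← ENNReal.ofNNReal_finsetSum,
      ← ENNReal.coe_mul, ENNReal.coe_le_coe]
    have h := log1p_prod_le Finset.univ ⟨k', Finset.mem_univ _⟩
      fun k => frameDensity pX W k (c k) i z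
    exact mul_le_mul_right h (codeDensity pX W c (i, z))
  refine (lintegral_mono hpt).trans ?_
  rw [lintegral_finsetSum _ (by fun_prop)]
  refine Finset.sum_le_sum fun k _ => ?_
  have he : Function.Injective fun b : Fin (B k) => (i, b) := Prod.mk_right_injective i
  have h := lintegral_pi_prod_comp_mul (fun l : Fin K => Measure.pi fun _ : Fin A × Fin (B l) =>
      Measure.pi fun _ : Fin M => Measure.pi fun _ : Fin n => pX l) Finset.univ id
    (Set.injOn_id _) (fun l c => (frameDensity pX W l c i z : ℝ≥0∞))
    (fun l c => (log1p (frameDensity pX W l c i z) : ℝ≥0∞)) (fun l => (hf l).coe_nnreal_ennreal)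
    (fun l => (measurable_log1p.comp (hf l)).coe_nnreal_ennreal) (fun l _ =>
      lintegral_average_pi _ _ (hw l) (lintegral_wordDensity hz l) fun b => (i, b))
    (Finset.mem_univ k)
  refine h.trans_le ?_
  simp only [← ENNReal.coe_mul]
  exact lintegral_average_mul_log1p_le _ _ (hw k) (lintegral_wordDensity hz k) _ he

end Expectation

/-! ### The bound on the expected leakage -/

section LeakageBound

variable {𝓧 𝓩 : Type*} [MeasurableSpace 𝓧] [MeasurableSpace 𝓩] [StandardBorelSpace 𝓩]
  {K M n A : ℕ} {B : Fin K → ℕ} (pX : Fin K → Measure 𝓧) (W : Fin K → Fin M → Kernel 𝓧 𝓩)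
  {k' : Fin K} {m' : Fin M} [∀ k, IsProbabilityMeasure (pX k)] [∀ k m, IsMarkovKernel (W k m)]

theorem ae_isRegularOutput
    (hI : ∀ q : SlotsUpTo k' m', mutualInfo (pX q.1.1 ⊗ₘ W q.1.1 q.1.2) ≠ ∞) :
    ∀ᵐ z ∂outputLaw n pX W k' m', IsRegularOutput pX W z := by
  simp only [IsRegularOutput, ae_all_iff]
  intro q t
  have h1 := (measurePreserving_eval (fun _ : Fin n => (pX q.1.1 ⊗ₘ W q.1.1 q.1.2).snd) t).comp
    (measurePreserving_eval (fun q : SlotsUpTo k' m' =>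
      Measure.pi fun _ : Fin n => (pX q.1.1 ⊗ₘ W q.1.1 q.1.2).snd) q)
  have h2 : MeasurePreserving (fun z : SlotsUpTo k' m' → Fin n → 𝓩 => z q t)
    (outputLaw n pX W k' m') (pX q.1.1 ⊗ₘ W q.1.1 q.1.2).snd := h1
  exact h2.quasiMeasurePreserving.ae (ae_lintegral_infoDensity (hI q))

variable (n) in
/-- The expected distance of the information density, in nats, of `n` uses of the channel of the
slot `q` from its mean. -/
def infoDeviation (q : SlotsUpTo k' m') : ℝ≥0∞ :=
  ∫⁻ ω, ‖∑ t, Real.log (infoDensity (pX q.1.1) (W q.1.1 q.1.2) (ω t)) -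
      n * ∫ y, Real.log (infoDensity (pX q.1.1) (W q.1.1 q.1.2) y) ∂(pX q.1.1 ⊗ₘ W q.1.1 q.1.2)‖ₑ
    ∂(Measure.pi fun _ : Fin n => pX q.1.1 ⊗ₘ W q.1.1 q.1.2)

variable {pX W}

theorem infoDeviation_ne_top (q : SlotsUpTo k' m')
    (hI : mutualInfo (pX q.1.1 ⊗ₘ W q.1.1 q.1.2) ≠ ∞) : infoDeviation n pX W q ≠ ∞ :=
  lintegral_sum_sub_integral_ne_top (pX q.1.1 ⊗ₘ W q.1.1 q.1.2)
    (fun y => Real.log (infoDensity (pX q.1.1) (W q.1.1 q.1.2) y))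
    (integrable_log_infoDensity hI) _ _

theorem tendsto_infoDeviation_div (q : SlotsUpTo k' m')
    (hI : mutualInfo (pX q.1.1 ⊗ₘ W q.1.1 q.1.2) ≠ ∞) :
    Tendsto (fun n : ℕ => infoDeviation n pX W q / n) atTop (𝓝 0) :=
  tendsto_lintegral_sum_sub_integral (pX q.1.1 ⊗ₘ W q.1.1 q.1.2)
    (fun y => Real.log (infoDensity (pX q.1.1) (W q.1.1 q.1.2) y)) (by fun_prop)
    (integrable_log_infoDensity hI)

variable (pX W)

theorem lintegral_klDiv_receivedLaw_le [NeZero A] [∀ k, NeZero (B k)]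
    (hI : ∀ q : SlotsUpTo k' m', mutualInfo (pX q.1.1 ⊗ₘ W q.1.1 q.1.2) ≠ ∞)
    (hB : ∀ k, ∑ q : SlotsUpTo k' m' with q.1.1 = k,
      n * ∫ y, Real.log (infoDensity (pX q.1.1) (W q.1.1 q.1.2) y) ∂(pX q.1.1 ⊗ₘ W q.1.1 q.1.2) ≤
        Real.log (B k)) :
    ∫⁻ c, klDiv (receivedLaw W k' m' c) ((uniformOn Set.univ).prod (outputLaw n pX W k' m'))
        ∂codeLaw M n A B pX ≤
      K * (ENNReal.ofReal (Real.log 2) + 1) +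
        ∑ q : SlotsUpTo k' m', infoDeviation n pX W q := by
  set I : SlotsUpTo k' m' → ℝ := fun q =>
    ∫ y, Real.log (infoDensity (pX q.1.1) (W q.1.1 q.1.2) y) ∂(pX q.1.1 ⊗ₘ W q.1.1 q.1.2)
  let Q := outputLaw n pX W k' m'
  let h : SlotsUpTo k' m' → (Fin n → 𝓩) → ℝ≥0∞ := fun q ζ =>
    ∫⁻ y, (slotDensity pX W q y ζ : ℝ≥0∞) *
      ‖∑ t, Real.log (infoDensity (pX q.1.1) (W q.1.1 q.1.2) (y t, ζ t)) - n * I q‖ₑ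
      ∂(Measure.pi fun _ : Fin n => pX q.1.1)
  have hh : ∀ q, Measurable (h q) := fun q => by
    refine Measurable.lintegral_prod_left' (f := fun y : (Fin n → 𝓧) × (Fin n → 𝓩) =>
      (slotDensity pX W q y.1 y.2 : ℝ≥0∞) *
      ‖∑ t, Real.log (infoDensity (pX q.1.1) (W q.1.1 q.1.2) (y.1 t, y.2 t)) - n * I q‖ₑ) ?_
    fun_prop
  have hh' : ∀ q : SlotsUpTo k' m', Measurable fun z : SlotsUpTo k' m' → Fin n → 𝓩 => h q (z q) :=
    fun q => (hh q).comp (measurable_pi_apply q)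
  have hhint : ∀ q : SlotsUpTo k' m', ∫⁻ z, h q (z q) ∂Q = infoDeviation n pX W q := fun q => by
    have h1 : ∫⁻ z, h q (z q) ∂Q = ∫⁻ ζ, h q ζ
        ∂(Measure.pi fun _ : Fin n => (pX q.1.1 ⊗ₘ W q.1.1 q.1.2).snd) :=
      (measurePreserving_eval (fun q : SlotsUpTo k' m' =>
        Measure.pi fun _ : Fin n => (pX q.1.1 ⊗ₘ W q.1.1 q.1.2).snd) q).lintegral_comp (hh q)
    rw [h1, infoDeviation, ← lintegral_lintegral_prod_infoDensity_mul (hI q) n _ (by fun_prop)]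
    simp only [h, slotDensity, ENNReal.ofNNReal_finsetProd]
    rfl
  have hm : Measurable fun y : HarqCode 𝓧 M n A B × (Fin A × (SlotsUpTo k' m' → Fin n → 𝓩)) =>
      ((codeDensity pX W y.1 y.2 * log1p (codeDensity pX W y.1 y.2) : ℝ≥0) : ℝ≥0∞) := by
    fun_prop
  have : IsProbabilityMeasure (codeLaw M n A B pX) := by
    unfold codeLaw
    infer_instance
  calc ∫⁻ c, klDiv (receivedLaw W k' m' c) ((uniformOn Set.univ).prod Q) ∂codeLaw M n A B pX
      ≤ ∫⁻ c, ∫⁻ y, (codeDensity pX W c y * log1p (codeDensity pX W c y) : ℝ≥0)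
          ∂((uniformOn Set.univ).prod Q) ∂codeLaw M n A B pX := by
        refine lintegral_mono_ae ?_
        filter_upwards [ae_codeLaw pX W hI] with c hc
        exact klDiv_withDensity_le _ _ _ (by fun_prop) (receivedLaw_eq_withDensity pX W c hc)
    _ = ∫⁻ i, ∫⁻ z, ∫⁻ c,
          (codeDensity pX W c (i, z) * log1p (codeDensity pX W c (i, z)) : ℝ≥0)
          ∂codeLaw M n A B pX ∂Q ∂uniformOn Set.univ := by
        rw [lintegral_lintegral_swap hm.aemeasurable,
          lintegral_prod _ (Measurable.lintegral_prod_left' hm).aemeasurable]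
    _ ≤ ∫⁻ i : Fin A, ∫⁻ z, (K * (ENNReal.ofReal (Real.log 2) + 1) + ∑ q, h q (z q)) ∂Q
          ∂uniformOn Set.univ := by
        refine lintegral_mono fun i => lintegral_mono_ae ?_
        filter_upwards [ae_isRegularOutput pX W hI] with z hz
        calc _ ≤ ∑ k, (∫⁻ x, (wordDensity pX W k x z * log1p (wordDensity pX W k x z / B k) : ℝ≥0)
              ∂(Measure.pi fun _ : Fin M => Measure.pi fun _ : Fin n => pX k) + 1) :=
              lintegral_codeDensity_mul_log1p_le hz i
          _ ≤ ∑ k, (ENNReal.ofReal (Real.log 2) +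
              ∑ q : SlotsUpTo k' m' with q.1.1 = k, h q (z q) + 1) := by
              gcongr with k
              exact lintegral_wordDensity_mul_log1p_le hz k I (hB k)
          _ = _ := by
              rw [← Finset.sum_fiberwise Finset.univ (fun q : SlotsUpTo k' m' => q.1.1)]
              simp only [Finset.sum_add_distrib, Finset.sum_const, Finset.card_univ,
                Fintype.card_fin, nsmul_eq_mul]
              ring
    _ = _ := by
        rw [lintegral_const, measure_univ, mul_one, lintegral_add_left measurable_const,
          lintegral_finsetSum _ (fun q _ => hh' q), lintegral_const, measure_univ, mul_one]
        simp only [hhint]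

variable (n k' m') in
/-- The upper bound, in bits per symbol, on the expected leakage. -/
def leakageRateBound : ℝ≥0∞ :=
  (K * (ENNReal.ofReal (Real.log 2) + 1) + ∑ q : SlotsUpTo k' m', infoDeviation n pX W q) / n /
    ENNReal.ofReal (Real.log 2)

variable {pX W} in
theorem leakageRateBound_ne_top
    (hI : ∀ q : SlotsUpTo k' m', mutualInfo (pX q.1.1 ⊗ₘ W q.1.1 q.1.2) ≠ ∞) (hn : n ≠ 0) :
    leakageRateBound n pX W k' m' ≠ ∞ := by
  have hlog : ENNReal.ofReal (Real.log 2) ≠ 0 := by simpa using Real.log_pos one_lt_two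
  have hsum : ∑ q : SlotsUpTo k' m', infoDeviation n pX W q ≠ ∞ :=
    ENNReal.sum_ne_top.2 fun q _ => infoDeviation_ne_top q (hI q)
  exact ENNReal.div_ne_top (ENNReal.div_ne_top (ENNReal.add_ne_top.2 ⟨by finiteness, hsum⟩)
    (by exact_mod_cast hn)) hlog

variable {pX W} in
theorem tendsto_leakageRateBound
    (hI : ∀ q : SlotsUpTo k' m', mutualInfo (pX q.1.1 ⊗ₘ W q.1.1 q.1.2) ≠ ∞) :
    Tendsto (fun n => leakageRateBound n pX W k' m') atTop (𝓝 0) := by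
  have hlog : ENNReal.ofReal (Real.log 2) ≠ 0 := by simpa using Real.log_pos one_lt_two
  have h1 : Tendsto (fun n : ℕ => (K * (ENNReal.ofReal (Real.log 2) + 1) : ℝ≥0∞) / n) atTop
      (𝓝 0) := by
    simpa [div_eq_mul_inv] using ENNReal.Tendsto.const_mul ENNReal.tendsto_inv_nat_nhds_zero
      (Or.inr (show (K * (ENNReal.ofReal (Real.log 2) + 1) : ℝ≥0∞) ≠ ∞ by finiteness))
  have h2 : Tendsto (fun n : ℕ => ∑ q : SlotsUpTo k' m', infoDeviation n pX W q / n) atTop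
      (𝓝 (∑ q : SlotsUpTo k' m', 0)) :=
    tendsto_finsetSum _ fun q _ => tendsto_infoDeviation_div q (hI q)
  have h3 := ENNReal.Tendsto.div_const (h1.add h2) (Or.inr hlog)
  rw [Finset.sum_const_zero, add_zero, ENNReal.zero_div] at h3
  refine h3.congr fun n => ?_
  simp only [leakageRateBound, div_eq_mul_inv, add_mul, Finset.sum_mul]

theorem lintegral_leakage_div_le [NeZero A] [∀ k, NeZero (B k)]
    (hI : ∀ q : SlotsUpTo k' m', mutualInfo (pX q.1.1 ⊗ₘ W q.1.1 q.1.2) ≠ ∞)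
    (hB : ∀ k, ∑ q : SlotsUpTo k' m' with q.1.1 = k,
      n * ∫ y, Real.log (infoDensity (pX q.1.1) (W q.1.1 q.1.2) y) ∂(pX q.1.1 ⊗ₘ W q.1.1 q.1.2) ≤
        Real.log (B k)) (hn : n ≠ 0) :
    ∫⁻ c, leakage W k' m' c / (n : ℝ≥0∞) ∂codeLaw M n A B pX ≤
      leakageRateBound n pX W k' m' := by
  have hlog : (ENNReal.ofReal (Real.log 2))⁻¹ ≠ ∞ := by
    simpa using Real.log_pos one_lt_two
  have hn' : (n : ℝ≥0∞)⁻¹ ≠ ∞ := by simpa using hn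
  calc ∫⁻ c, leakage W k' m' c / (n : ℝ≥0∞) ∂codeLaw M n A B pX
      ≤ ∫⁻ c, klDiv (receivedLaw W k' m' c)
          ((uniformOn Set.univ).prod (outputLaw n pX W k' m')) *
            ((ENNReal.ofReal (Real.log 2))⁻¹ * (n : ℝ≥0∞)⁻¹) ∂codeLaw M n A B pX := by
        refine lintegral_mono fun c => ?_
        rw [← mul_assoc, ← div_eq_mul_inv, ← div_eq_mul_inv]
        gcongr
        exact leakage_le W k' m' c _
    _ ≤ _ := by
        rw [lintegral_mul_const' _ _ (ENNReal.mul_ne_top hlog hn'), leakageRateBound,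
          div_eq_mul_inv, div_eq_mul_inv, mul_assoc, mul_comm (n : ℝ≥0∞)⁻¹]
        gcongr
        exact lintegral_klDiv_receivedLaw_le pX W hI hB

end LeakageBound

instance neZero_numMessages (n : ℕ) (R : ℝ) : NeZero (numMessages n R) :=
  ⟨(Nat.ceil_pos.2 (by positivity)).ne'⟩

theorem mul_log_two_le_log_numMessages (n : ℕ) (R : ℝ) :
    n * R * Real.log 2 ≤ Real.log (numMessages n R) := by
  rw [← Real.log_rpow two_pos]
  exact Real.log_le_log (by positivity) (Nat.le_ceil _)

/-- The hypothesis on the rates, for all the frames: those after `k'` have no observed slot, and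
the left side is then an empty sum. -/
theorem sum_integral_log_infoDensity_le {𝓧 𝓩 : Type*} [MeasurableSpace 𝓧] [MeasurableSpace 𝓩]
    [MeasurableSpace.CountableOrCountablyGenerated 𝓧 𝓩] {K M : ℕ} {Rd : Fin K → ℝ}
    {pX : Fin K → Measure 𝓧} [∀ k, IsProbabilityMeasure (pX k)]
    {W : Fin K → Fin M → Kernel 𝓧 𝓩} [∀ k m, IsMarkovKernel (W k m)] {k' : Fin K} {m' : Fin M}
    (hI : ∀ q : SlotsUpTo k' m', mutualInfo (pX q.1.1 ⊗ₘ W q.1.1 q.1.2) ≠ ∞)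
    (hR : ∀ k ≤ k', ∑ q : SlotsUpTo k' m' with q.1.1 = k, slotInfo (pX k) (W k q.1.2) <
      ENNReal.ofReal (Rd k)) (n : ℕ) (k : Fin K) :
    ∑ q : SlotsUpTo k' m' with q.1.1 = k,
      n * ∫ y, Real.log (infoDensity (pX q.1.1) (W q.1.1 q.1.2) y) ∂(pX q.1.1 ⊗ₘ W q.1.1 q.1.2) ≤
        Real.log (numMessages n (Rd k)) := by
  by_cases hk : k ≤ k'
  · have h1 := hR k hk
    have hpos : 0 < Rd k := ENNReal.ofReal_pos.1 (zero_le.trans_lt h1)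
    have h2 : ∑ q : SlotsUpTo k' m' with q.1.1 = k,
        (mutualInfo (pX q.1.1 ⊗ₘ W q.1.1 q.1.2)).toReal ≤ Rd k := by
      rw [← ENNReal.toReal_sum fun q _ => hI q]
      refine ENNReal.toReal_le_of_le_ofReal hpos.le (le_of_eq_of_le ?_ h1.le)
      refine Finset.sum_congr rfl fun q hq => ?_
      obtain rfl := (Finset.mem_filter.1 hq).2
      rw [slotInfo_eq]
    refine le_trans (le_of_eq_of_le ?_ (mul_le_mul_of_nonneg_right
      (mul_le_mul_of_nonneg_left h2 (Nat.cast_nonneg n)) (Real.log_nonneg one_le_two)))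
      (mul_log_two_le_log_numMessages n (Rd k))
    rw [Finset.mul_sum, Finset.sum_mul]
    refine Finset.sum_congr rfl fun q _ => ?_
    rw [integral_log_infoDensity (hI q), mul_assoc]
  · rw [Finset.filter_false_of_mem, Finset.sum_empty]
    · exact Real.log_natCast_nonneg _
    · rintro q - rfl
      rcases q.2 with h | h
      · exact hk h.le
      · exact hk h.1.le

theorem sum_slotsUpTo_filter {K M : ℕ} {k' : Fin K} {m' : Fin M} {α : Type*} [AddCommMonoid α]
    (f : Fin M → α) (k : Fin K) :
    ∑ q : SlotsUpTo k' m' with q.1.1 = k, f q.1.2 =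
      ∑ m : Fin M with k < k' ∨ k = k' ∧ m ≤ m', f m := by
  refine Finset.sum_bij (fun q _ => q.1.2) ?_ ?_ ?_ ?_
  · rintro q hq
    obtain rfl := (Finset.mem_filter.1 hq).2
    simpa using q.2
  · exact fun q hq r hr h => injOn_slot k hq hr h
  · exact fun m hm => ⟨⟨(k, m), (Finset.mem_filter.1 hm).2⟩, by simp, rfl⟩
  · exact fun _ _ => rfl

theorem sum_slotInfo_lt_ofReal {𝓧 𝓩 : Type*} [MeasurableSpace 𝓧] [MeasurableSpace 𝓩] {K M : ℕ}
    {Rd : Fin K → ℝ} {pX : Fin K → Measure 𝓧} {W : Fin K → Fin M → Kernel 𝓧 𝓩}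
    {k' : Fin K} {m' : Fin M}
    (hframes : ∀ k < k', ∑ m : Fin M, slotInfo (pX k) (W k m) < ENNReal.ofReal (Rd k))
    (hlast : ∑ m ∈ Finset.Iic m', slotInfo (pX k') (W k' m) < ENNReal.ofReal (Rd k'))
    (k : Fin K) (hk : k ≤ k') :
    ∑ q : SlotsUpTo k' m' with q.1.1 = k, slotInfo (pX k) (W k q.1.2) <
      ENNReal.ofReal (Rd k) := by
  rw [sum_slotsUpTo_filter fun m => slotInfo (pX k) (W k m)]
  rcases hk.lt_or_eq with h | rfl
  · exact (Finset.sum_le_sum_of_subset (Finset.subset_univ _)).trans_lt (hframes k h)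
  · convert! hlast using 2
    ext m
    simp

end

end SHARQ

theorem lemma4 {𝓧 𝓩 : Type*} [MeasurableSpace 𝓧] [StandardBorelSpace 𝓧]
    [MeasurableSpace 𝓩] [StandardBorelSpace 𝓩] (K M : ℕ) (Rs : ℝ) (Rd : Fin K → ℝ)
    (pX : Fin K → Measure 𝓧) [∀ k, IsProbabilityMeasure (pX k)]
    (W : Fin K → Fin M → Kernel 𝓧 𝓩) [∀ k m, IsMarkovKernel (W k m)]
    (k' : Fin K) (m' : Fin M)
    (hframes : ∀ k < k', ∑ m : Fin M, SHARQ.slotInfo (pX k) (W k m) < ENNReal.ofReal (Rd k))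
    (hlast : ∑ m ∈ Finset.Iic m', SHARQ.slotInfo (pX k') (W k' m) < ENNReal.ofReal (Rd k')) :
    ∃ (δ : ℝ → ℝ≥0) (δ' : ℝ → ℕ → ℝ≥0), Tendsto δ (𝓝[>] 0) (𝓝 0) ∧
      ∀ ε > 0, Tendsto (δ' ε) atTop (𝓝 0) ∧
        ∀ n ≥ 1,
          Measurable (fun c : SHARQ.HarqCode 𝓧 M n (SHARQ.numMessages n Rs)
            (fun k => SHARQ.numMessages n (Rd k)) => SHARQ.leakage W k' m' c) ∧
          ∫⁻ c, SHARQ.leakage W k' m' c / (n : ℝ≥0∞)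
              ∂(SHARQ.codeLaw M n (SHARQ.numMessages n Rs)
                (fun k => SHARQ.numMessages n (Rd k)) pX)
            ≤ ((k' : ℕ) + 1) * δ ε + ((k' : ℕ) + 1) * δ' ε n := by
  have hR := SHARQ.sum_slotInfo_lt_ofReal hframes hlast
  have hI : ∀ q : SHARQ.SlotsUpTo k' m', SHARQ.mutualInfo (pX q.1.1 ⊗ₘ W q.1.1 q.1.2) ≠ ∞ := by
    intro q
    have hq : q.1.1 ≤ k' := q.2.elim le_of_lt fun h => h.1.le
    rw [← SHARQ.slotInfo_eq]
    exact (ENNReal.lt_top_of_sum_ne_top (hR q.1.1 hq).ne_top (a := q) (by simp)).ne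
  -- The bound is uniform in `ε`, and finite because `n ≥ 1`: all of it goes into the sequence.
  refine ⟨0, fun _ n => (SHARQ.leakageRateBound n pX W k' m').toNNReal, tendsto_const_nhds,
    fun ε _ => ⟨?_, fun n hn => ⟨SHARQ.measurable_leakage W k' m', ?_⟩⟩⟩
  · exact (ENNReal.tendsto_toNNReal ENNReal.zero_ne_top).comp (SHARQ.tendsto_leakageRateBound hI)
  have hn0 : n ≠ 0 := Nat.one_le_iff_ne_zero.1 hn
  refine (SHARQ.lintegral_leakage_div_le pX W hI
    (SHARQ.sum_integral_log_infoDensity_le hI hR n) hn0).trans ?_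
  rw [ENNReal.coe_toNNReal (SHARQ.leakageRateBound_ne_top hI hn0)]
  exact (le_mul_of_one_le_left zero_le (by simp)).trans le_add_self
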